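/- Let $\mathbb K$ be $\mathbb R$ or $\mathbb C$, let $M$ be an analytic manifold of dimension $n$ over $\mathbb K$ with structure sheaf $\mathcal O_M$, and let $Der_M$ be the sheaf of analytic vector fields on $M$. An involutive singular distribution on $M$ is a coherent subsheaf $\theta\subseteq Der_M$ of $\mathcal O_M$-modules whose stalks $\theta_p$ are closed under the Lie bracket. It is a $d$-singular distribution if, at each $p$ where $(Der_M/\theta)_p$ is a free $\mathcal O_p$-module, the values at $p$ of the elements of $\theta_p$ span a subspace of $T_pM$ of dimension $d$; it is regular if $(Der_M/\theta)_p$ is a free $\mathcal O_p$-module for every $p\in M$. For a closed submanifold $N$ let $\mathcal I_N$ be the ideal sheaf of the analytic functions vanishing on $N$; $N$ is $\theta$-invariant if $X(g)\in\mathcal I_{N,p}$ for all $p$, $X\in\theta_p$ and $g\in\mathcal I_{N,p}$. A $d$-foliated manifold $(M,\theta,E)$ consists of $M$, an involutive $d$-singular distribution $\theta$ on $M$, and an ordered collection $E=(E^{(1)},\dots,E^{(l)})$ of smooth divisors whose sum is a reduced divisor with simple normal crossings, each $E^{(i)}$ being $\theta$-invariant. A center $\mathcal C\subseteq M$ is admissible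 if it is a closed submanifold with simple normal crossings with $E$: near each $p\in\mathcal C$ there are coordinates in which $\mathcal C$ is a coordinate subspace and the $E^{(i)}$ passing through $p$ are given by the vanishing of distinct coordinates. Let $\sigma\colon M'\to M$ be the blowing-up with center $\mathcal C$ and let $F=\sigma^{-1}(\mathcal C)$ be its exceptional divisor. For a vector field $X$ on $M$, the pull-back $X^*$ is the vector field on $M'$, with poles of order at most one along $F$, such that $d\sigma(X^*)=X\circ\sigma$. The total transform $\theta^*$ is the sheaf of $\mathcal O_{M'}$-submodules of $\mathcal O(F)\otimes Der_{M'}$ generated by the $X^*$ with $X\in\theta$; the analytic strict transform $\theta^a\subseteq Der_{M'}$ consists of the analytic vector fields $W$ with $1\otimes W\in\theta^*$; and the adapted analytic strict transform is $\theta'=\theta^a\cap Der_{M'}(-\log F)$, where $Der_{M'}(-\log F)$ is the sheaf of the analytic vector fields $W$ with $W(\mathcal I_F)\subseteq\mathcal I_F$. Then: if $(M,\theta,E)$ is a $d$-foliated manifold, $\theta$ is regular, and $\sigma$ is the blowing-up of an admissible center $\mathcal C$ that is $\theta$-invariant, the transform $\theta'$ is a regular involutive $d$-singular distribution on $M'$.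 -/

import Mathlib

open Filter Set
open scoped Manifold ContDiff Topology LinearAlgebra.Projectivization

noncomputable section

namespace Foliated

section Manifold

/- `M` is an analytic manifold of dimension `n` over `𝕜`, which is `ℝ` or `ℂ`. -/
variable (𝕜 : Type*) [RCLike 𝕜] (n : ℕ)

/-- Vector fields on `M` (no regularity imposed). -/
abbrev Field (M : Type*) [TopologicalSpace M] [ChartedSpace (Fin n → 𝕜) M] : Type _ :=
  (x : M) → TangentSpace 𝓘(𝕜, Fin n → 𝕜) x

variable {M : Type*} [TopologicalSpace M] [ChartedSpace (Fin n → 𝕜) M]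

/-- The function `g` is analytic at (hence near) `p`. -/
def FunAnalyticAt (g : M → 𝕜) (p : M) : Prop :=
  ContMDiffAt 𝓘(𝕜, Fin n → 𝕜) 𝓘(𝕜, 𝕜) ω g p

variable {𝕜 n} in
/-- The germ at `p` of a vector field.  (Mathlib's `TangentSpace I x` is by definition a copy
of the model space, so a germ of vector field is represented by a germ of map to that space.) -/
def fieldGerm (p : M) (X : Field 𝕜 n M) : Germ (𝓝 p) (Fin n → 𝕜) :=
  Germ.ofFun (β := Fin n → 𝕜) fun x => X x

variable {𝕜 n} in
/-- The derivative `X(g)` of a function along a vector field. -/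
def act (X : Field 𝕜 n M) (g : M → 𝕜) : M → 𝕜 :=
  fun x => (mfderiv 𝓘(𝕜, Fin n → 𝕜) 𝓘(𝕜, 𝕜) g x (X x) : 𝕜)

/-- The ring `𝒪_p` of germs at `p` of analytic functions. -/
def Stalk (p : M) : Subring (Germ (𝓝 p) 𝕜) where
  carrier := {g | ∃ f : M → 𝕜, FunAnalyticAt 𝕜 n f p ∧ g = (f : Germ (𝓝 p) 𝕜)}
  mul_mem' := by
    rintro _ _ ⟨f, hf, rfl⟩ ⟨g, hg, rfl⟩
    exact ⟨f * g, ContMDiffAt.mul hf hg, rfl⟩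
  add_mem' := by
    rintro _ _ ⟨f, hf, rfl⟩ ⟨g, hg, rfl⟩
    exact ⟨f + g, ContMDiffAt.add hf hg, rfl⟩
  zero_mem' := ⟨fun _ => 0, contMDiffAt_const, rfl⟩
  one_mem' := ⟨fun _ => 1, contMDiffAt_const, rfl⟩
  neg_mem' := by
    rintro _ ⟨f, hf, rfl⟩
    exact ⟨-f, ContMDiffAt.neg hf, rfl⟩

/-- The stalk at `p` of the reduced ideal sheaf `I_N` of a closed submanifold `N`: the germs of
analytic functions vanishing on `N`. -/
def idealStalk (N : Set M) (p : M) : Ideal (Stalk 𝕜 n p) where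
  carrier := {g | ∃ f : M → 𝕜, (g : Germ (𝓝 p) 𝕜) = (f : Germ (𝓝 p) 𝕜) ∧
    ∀ᶠ x in 𝓝 p, x ∈ N → f x = 0}
  zero_mem' := ⟨0, rfl, by simp⟩
  add_mem' := by
    rintro a b ⟨f, hf, hf0⟩ ⟨g, hg, hg0⟩
    refine ⟨f + g, by rw [Subring.coe_add, hf, hg]; rfl, ?_⟩
    filter_upwards [hf0, hg0] with x h1 h2 hx
    simp [h1 hx, h2 hx]
  smul_mem' := by
    rintro ⟨_, f, hf, rfl⟩ b ⟨g, hg, hg0⟩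
    refine ⟨f * g, by rw [smul_eq_mul, Subring.coe_mul, hg]; rfl, ?_⟩
    filter_upwards [hg0] with x h2 hx
    simp [h2 hx]

variable {𝕜 n} in
/-- The vector field `X` leaves the ideal of `N` at `p` invariant: `X(I_{N,p}) ⊆ I_{N,p}`. -/
def Preserves (X : Field 𝕜 n M) (N : Set M) (p : M) : Prop :=
  ∀ g : M → 𝕜, FunAnalyticAt 𝕜 n g p → (∀ᶠ x in 𝓝 p, x ∈ N → g x = 0) →
    ∀ᶠ x in 𝓝 p, x ∈ N → act X g x = 0

variable [IsManifold 𝓘(𝕜, Fin n → 𝕜) ω M]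

variable {𝕜 n} in
/-- The vector field `X` is analytic at (hence near) `p`, as a section of the tangent bundle. -/
def FieldAnalyticAt (X : Field 𝕜 n M) (p : M) : Prop :=
  ContMDiffAt 𝓘(𝕜, Fin n → 𝕜) (𝓘(𝕜, Fin n → 𝕜)).tangent ω
    (fun x => (⟨x, X x⟩ : TangentBundle 𝓘(𝕜, Fin n → 𝕜) M)) p

/-- The `𝒪_p`-module `Der_{M,p}` of germs at `p` of analytic vector fields. -/
def DerStalk (p : M) : Submodule (Stalk 𝕜 n p) (Germ (𝓝 p) (Fin n → 𝕜)) where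
  carrier := {v | ∃ X : Field 𝕜 n M, FieldAnalyticAt X p ∧ v = fieldGerm p X}
  zero_mem' := ⟨fun _ => 0, (Bundle.contMDiff_zeroSection 𝕜
    (TangentSpace 𝓘(𝕜, Fin n → 𝕜) : M → Type _)).contMDiffAt, rfl⟩
  add_mem' := by
    rintro _ _ ⟨X, hX, rfl⟩ ⟨Y, hY, rfl⟩
    exact ⟨fun x => X x + Y x, ContMDiffAt.add_section hX hY, rfl⟩
  smul_mem' := by
    rintro ⟨_, f, hf, rfl⟩ _ ⟨X, hX, rfl⟩
    exact ⟨fun x => f x • X x, ContMDiffAt.smul_section hf hX, rfl⟩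

/- Shortcut instances, for faster type class search. -/
instance (p : M) : AddCommGroup (DerStalk 𝕜 n p) := Submodule.addCommGroup _

instance (p : M) : Module (Stalk 𝕜 n p) (DerStalk 𝕜 n p) := Submodule.module _

instance (p : M) : SMul (Stalk 𝕜 n p) (DerStalk 𝕜 n p) := Submodule.smul _

/-- The module `Der_{M,p}(-log N)` of the germs of analytic vector fields that leave the ideal of
`N` invariant. -/
def logDer (N : Set M) (p : M) : Submodule (Stalk 𝕜 n p) (DerStalk 𝕜 n p) where
  carrier := {v | ∀ X : Field 𝕜 n M, (v : Germ (𝓝 p) (Fin n → 𝕜)) = fieldGerm p X →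
    Preserves X N p}
  zero_mem' := by
    intro X hX g _ _
    have h : ∀ᶠ x in 𝓝 p, (0 : Fin n → 𝕜) = X x := Germ.coe_eq.1 hX
    filter_upwards [h] with x hx _
    have hx' : X x = 0 := hx.symm
    rw [act, hx']
    exact map_zero _
  add_mem' := by
    rintro ⟨_, X, hX, rfl⟩ ⟨_, Y, hY, rfl⟩ h1 h2 Z hZ g hg hg0
    have h : ∀ᶠ x in 𝓝 p, X x + Y x = Z x := Germ.coe_eq.1 hZ
    filter_upwards [h, h1 X rfl g hg hg0, h2 Y rfl g hg hg0] with x hx h3 h4 hxN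
    have e : act Z g x = act X g x + act Y g x := by
      rw [act, ← hx]
      exact map_add _ _ _
    rw [e, h3 hxN, h4 hxN, add_zero]
  smul_mem' := by
    rintro ⟨_, f, hf, rfl⟩ ⟨_, X, hX, rfl⟩ h1 Z hZ g hg hg0
    have h : ∀ᶠ x in 𝓝 p, f x • X x = Z x := Germ.coe_eq.1 hZ
    filter_upwards [h, h1 X rfl g hg hg0] with x hx h3 hxN
    have e : act Z g x = f x • act X g x := by
      rw [act, ← hx]
      exact map_smul _ _ _
    rw [e, h3 hxN, smul_zero]

/-- A sheaf of `𝒪_M`-submodules of `Der_M`, given by its stalks.  (A subsheaf is determined by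
its stalks; that a family of stalks does come from a subsheaf is part of `IsCoherent`.) -/
abbrev StalkFamily (M : Type*) [TopologicalSpace M] [ChartedSpace (Fin n → 𝕜) M]
    [IsManifold 𝓘(𝕜, Fin n → 𝕜) ω M] : Type _ :=
  (p : M) → Submodule (Stalk 𝕜 n p) (DerStalk 𝕜 n p)

variable {𝕜 n}

/-- The germ of `X` at `p` belongs to `θ_p`. -/
def StalkFamily.Mem (θ : StalkFamily 𝕜 n M) (p : M) (X : Field 𝕜 n M) : Prop :=
  ∃ v ∈ θ p, (v : Germ (𝓝 p) (Fin n → 𝕜)) = fieldGerm p X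

/-- Coherence of a submodule of the locally free sheaf `Der_M`: each point has an open
neighbourhood `U` and finitely many vector fields on `U` whose germs generate `θ_q` for all
`q ∈ U` (a coherent set of generators). -/
def IsCoherent (θ : StalkFamily 𝕜 n M) : Prop :=
  ∀ p : M, ∃ U : Set M, IsOpen U ∧ p ∈ U ∧ ∃ (r : ℕ) (X : Fin r → Field 𝕜 n M), ∀ q ∈ U,
    (θ q).map (DerStalk 𝕜 n q).subtype =
      Submodule.span (Stalk 𝕜 n q) (Set.range fun i => fieldGerm q (X i))

/-- Each stalk is closed under the Lie bracket. -/
def IsInvolutive (θ : StalkFamily 𝕜 n M) : Prop :=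
  ∀ (p : M) (X Y : Field 𝕜 n M), θ.Mem p X → θ.Mem p Y →
    θ.Mem p (VectorField.mlieBracket 𝓘(𝕜, Fin n → 𝕜) X Y)

/-- The set of points where the stalk of `Der_M / θ` is not a free `𝒪_p`-module. -/
def singularSet (θ : StalkFamily 𝕜 n M) : Set M :=
  {p | ¬ Module.Free (Stalk 𝕜 n p) (DerStalk 𝕜 n p ⧸ θ p)}

/-- `θ` is regular: its singular set is empty. -/
def IsRegular (θ : StalkFamily 𝕜 n M) : Prop := singularSet θ = ∅

/-- The subspace `L_p` of `T_pM` of the values at `p` of the elements of `θ_p`. -/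
def values (θ : StalkFamily 𝕜 n M) (p : M) :
    Submodule 𝕜 (TangentSpace 𝓘(𝕜, Fin n → 𝕜) p) :=
  Submodule.span 𝕜 {v | ∃ X : Field 𝕜 n M, θ.Mem p X ∧ X p = v}

/-- The leaf dimension of `θ` is `d`: off the singular set, `L` has rank `d`. -/
def HasLeafDim (θ : StalkFamily 𝕜 n M) (d : ℕ) : Prop :=
  ∀ p ∉ singularSet θ, Module.finrank 𝕜 (values θ p) = d

/-- `θ` is an involutive `d`-singular distribution. -/
structure IsSingularDistribution (θ : StalkFamily 𝕜 n M) (d : ℕ) : Prop where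
  coherent : IsCoherent θ
  involutive : IsInvolutive θ
  leafDim : HasLeafDim θ d

/-- The submanifold `N` is invariant by `θ` (`θ` is tangent to `N`): `θ[I_N] ⊆ I_N`. -/
def IsInvariant (θ : StalkFamily 𝕜 n M) (N : Set M) : Prop :=
  ∀ (p : M) (X : Field 𝕜 n M), θ.Mem p X → Preserves X N p

variable (𝕜 n)

/-- The chart `φ` is adapted at `p` to the collection `E`: in `φ`, the members of `E` that pass
through `p` are given by the vanishing of pairwise distinct coordinates. -/
def AdaptedAt (φ : OpenPartialHomeomorph M (Fin n → 𝕜)) {l : ℕ} (E : Fin l → Set M)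
    (p : M) : Prop :=
  φ ∈ IsManifold.maximalAtlas 𝓘(𝕜, Fin n → 𝕜) ω M ∧ p ∈ φ.source ∧
    ∃ c : {i // p ∈ E i} → Fin n, Function.Injective c ∧
      ∀ (i : {i // p ∈ E i}), ∀ x ∈ φ.source, x ∈ E i ↔ φ x (c i) = 0

/-- In the chart `φ`, the set `C` is the coordinate subspace `x_i = 0` for `i ∈ S`. -/
def CutOut (φ : OpenPartialHomeomorph M (Fin n → 𝕜)) (S : Finset (Fin n)) (C : Set M) : Prop :=
  ∀ x ∈ φ.source, x ∈ C ↔ ∀ i ∈ S, φ x i = 0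

/-- `E` is an ordered collection of smooth divisors whose sum is a reduced divisor with simple
normal crossings. -/
def IsSNC {l : ℕ} (E : Fin l → Set M) : Prop :=
  (∀ i, IsClosed (E i)) ∧ ∀ p : M, ∃ φ, AdaptedAt 𝕜 n φ E p

/-- `C` is an admissible centre: a closed submanifold having simple normal crossings
with `E`. -/
def IsAdmissibleCenter {l : ℕ} (E : Fin l → Set M) (C : Set M) : Prop :=
  IsClosed C ∧ ∀ p ∈ C, ∃ φ, AdaptedAt 𝕜 n φ E p ∧ ∃ S, CutOut 𝕜 n φ S C

variable {𝕜 n}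

/-- `(M, θ, E)` is a `d`-foliated manifold. -/
structure IsFoliatedManifold (θ : StalkFamily 𝕜 n M) {l : ℕ} (E : Fin l → Set M) (d : ℕ) :
    Prop where
  snc : IsSNC 𝕜 n E
  distribution : IsSingularDistribution θ d
  tangent : ∀ i, IsInvariant θ (E i)

end Manifold

section Blowup

variable (𝕜 : Type*) [RCLike 𝕜] (n : ℕ)

/-- The blowing-up of an open set `U` of `𝕜^n` along the coordinate subspace `x_i = 0, i ∈ S`:
the pairs `(x, L)` of a point `x ∈ U` and a line `L` in `𝕜^S` that contains `(x_i)_{i ∈ S}`. -/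
def LocalBlowup (S : Finset (Fin n)) (U : Set (Fin n → 𝕜)) : Type _ :=
  {z : (Fin n → 𝕜) × ℙ 𝕜 (S → 𝕜) // z.1 ∈ U ∧ (fun i : S => z.1 i) ∈ z.2.submodule}

variable {𝕜 n}

/-- The `j`-th affine chart of the local blowing-up (`j ∈ S`), defined where the `j`-th
homogeneous coordinate `L_j` is not zero: its components are `L_i / L_j` for `i ∈ S`, `i ≠ j`,
and `x_i` for the other indices `i`. -/
def affineChart {S : Finset (Fin n)} {U : Set (Fin n → 𝕜)} (j : S) (z : LocalBlowup 𝕜 n S U) :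
    Fin n → 𝕜 :=
  fun i => if h : i ∈ S ∧ i ≠ j then z.1.2.rep ⟨i, h.1⟩ / z.1.2.rep j else z.1.1 i

variable {M : Type*} [TopologicalSpace M] [ChartedSpace (Fin n → 𝕜) M]
  [IsManifold 𝓘(𝕜, Fin n → 𝕜) ω M]
variable {M' : Type*} [TopologicalSpace M'] [ChartedSpace (Fin n → 𝕜) M']
  [IsManifold 𝓘(𝕜, Fin n → 𝕜) ω M']

variable (𝕜 n) in
/-- The analytic map `σ : M' → M` is the blowing-up with centre `C`: it is an analytic
isomorphism over `M \ C`, and near each point of `C` it is isomorphic, in a chart of `M` where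
`C` is a coordinate subspace, to the local blowing-up with its affine charts. -/
structure IsBlowup (σ : M' → M) (C : Set M) : Prop where
  analytic : ContMDiff 𝓘(𝕜, Fin n → 𝕜) 𝓘(𝕜, Fin n → 𝕜) ω σ
  iso : ∃ τ : M → M', ContMDiffOn 𝓘(𝕜, Fin n → 𝕜) 𝓘(𝕜, Fin n → 𝕜) ω τ Cᶜ ∧
    (∀ x ∉ C, σ (τ x) = x) ∧ ∀ y, σ y ∉ C → τ (σ y) = y
  model : ∀ p ∈ C, ∃ φ ∈ IsManifold.maximalAtlas 𝓘(𝕜, Fin n → 𝕜) ω M, p ∈ φ.source ∧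
    ∃ S : Finset (Fin n), CutOut 𝕜 n φ S C ∧
    ∃ Ψ : {y // σ y ∈ φ.source} ≃ LocalBlowup 𝕜 n S φ.target,
      (∀ y, (Ψ y).1.1 = φ (σ y)) ∧
      ∀ j : S, ∃ ψ ∈ IsManifold.maximalAtlas 𝓘(𝕜, Fin n → 𝕜) ω M',
        ψ.source = {y | ∃ h : σ y ∈ φ.source, (Ψ ⟨y, h⟩).1.2.rep j ≠ 0} ∧
        ∀ y (h : σ y ∈ φ.source), y ∈ ψ.source → ψ y = affineChart j (Ψ ⟨y, h⟩)

/-- The vector field `V` is `g · X^*` near `q`, where `X^*` is the pull-back of `X`: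
`dσ(V) = g · (X ∘ σ)`. -/
def IsMulPullbackAt (σ : M' → M) (q : M') (g : M' → 𝕜) (X : Field 𝕜 n M) (V : Field 𝕜 n M') :
    Prop :=
  ∀ᶠ y in 𝓝 q, mfderiv 𝓘(𝕜, Fin n → 𝕜) 𝓘(𝕜, Fin n → 𝕜) σ y (V y) = g y • X (σ y)

variable (𝕜 n) in
/-- The stalk at `q` of the sheaf `𝒪(F) ⊗ Der_{M'}` of vector fields with poles of order at most
one along the divisor `F`, as `Hom(I_F, Der_{M'})`: the field `(1/f) ⊗ W`, where `f` generates
`I_F`, is the homomorphism that sends `f` to `W`. -/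
abbrev BlDer (F : Set M') (q : M') : Type _ :=
  idealStalk 𝕜 n F q →ₗ[Stalk 𝕜 n q] DerStalk 𝕜 n q

variable (𝕜 n) in
/-- The inclusion `ζ` of `Der_{M'}` in `𝒪(F) ⊗ Der_{M'}`, `W ↦ 1 ⊗ W`. -/
def zeta (F : Set M') (q : M') : DerStalk 𝕜 n q →ₗ[Stalk 𝕜 n q] BlDer 𝕜 n F q where
  toFun W :=
    { toFun := fun f => (f : Stalk 𝕜 n q) • W
      map_add' := fun f g => add_smul (f : Stalk 𝕜 n q) (g : Stalk 𝕜 n q) W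
      map_smul' := fun a f => mul_smul a (f : Stalk 𝕜 n q) W }
  map_add' V W := LinearMap.ext fun f => smul_add (f : Stalk 𝕜 n q) V W
  map_smul' a W := LinearMap.ext fun f => smul_comm (f : Stalk 𝕜 n q) a W

/-- The element `Φ` of `𝒪(F) ⊗ Der_{M'}` is the pull-back `σ^*(X) = X^*`: it sends each
`f ∈ I_F` to `f · X^*`. -/
def IsPullback (σ : M' → M) (F : Set M') (q : M') (X : Field 𝕜 n M) (Φ : BlDer 𝕜 n F q) :
    Prop :=
  ∀ f : idealStalk 𝕜 n F q, ∃ (g : M' → 𝕜) (V : Field 𝕜 n M'),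
    ((f : Stalk 𝕜 n q) : Germ (𝓝 q) 𝕜) = (g : Germ (𝓝 q) 𝕜) ∧
    ((Φ f : DerStalk 𝕜 n q) : Germ (𝓝 q) (Fin n → 𝕜)) = fieldGerm q V ∧
    IsMulPullbackAt σ q g X V

/-- The stalk at `q` of the total transform `θ^*`: the submodule of `𝒪(F) ⊗ Der_{M'}` generated
by the pull-backs of the elements of `θ`, where `F = σ⁻¹(C)`. -/
def totalTransform (σ : M' → M) (C : Set M) (θ : StalkFamily 𝕜 n M) (q : M') :
    Submodule (Stalk 𝕜 n q) (BlDer 𝕜 n (σ ⁻¹' C) q) :=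
  Submodule.span (Stalk 𝕜 n q) {Φ | ∃ X, θ.Mem (σ q) X ∧ IsPullback σ (σ ⁻¹' C) q X Φ}

/-- The analytic strict transform `θ^a = ζ⁻¹(θ^*)`. -/
def analyticStrictTransform (σ : M' → M) (C : Set M) (θ : StalkFamily 𝕜 n M) :
    StalkFamily 𝕜 n M' :=
  fun q => (totalTransform σ C θ q).comap (zeta 𝕜 n (σ ⁻¹' C) q)

/-- The adapted analytic strict transform `θ' = θ^a ∩ Der_{M'}(-log F)`, where `F = σ⁻¹(C)` is
the exceptional divisor. -/
def adaptedTransform (σ : M' → M) (C : Set M) (θ : StalkFamily 𝕜 n M) : StalkFamily 𝕜 n M' :=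
  fun q => analyticStrictTransform σ C θ q ⊓ logDer 𝕜 n (σ ⁻¹' C) q

end Blowup

end Foliated

end

/-! Regularity is equivalent to the local existence of frames. If `Der_p / θ_p` is free, then `θ_p ∩
𝔪_p Der_p = 𝔪_p θ_p`, and Nakayama's lemma shows that `d` elements of `θ_p` with independent values
at `p` generate `θ_p`, hence θ near `p` by coherence (`IsSingularDistribution.exists_isFrameAt`).
Conversely, `d` generators with independent values extend to a basis of `Der_p`, which gives
coherence, free quotients and leaf dimension `d`. So it is enough to lift a frame of θ to a frame of
θ'.

In an affine chart of the blowing-up, `x_j = y_j` and `x_i = y_i y_j` for the other equations `x_i`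
of the centre, and `F` is `y_j = 0`. If `X` leaves the centre invariant, the functions `X(x_i) ∘ σ`
vanish on `F`, so they are `y_j b_i` with `b_i` analytic (`exists_analyticAt_eq_smul`). Therefore
`X^*` has no pole and is tangent to `F` (`IsBlowup.exists_lift`). The lifts of a frame generate θ'
(`adaptedTransform_generate`), and their values are independent even on `F`, because `dσ` sends them
to the independent values of the frame below.

For involutivity, off `F` the map σ is a local isomorphism and brackets are computed on `M`. Since
the complement of `F` is dense, the components of a bracket transverse to the lifted frame vanish
everywhere (`mem_span_germs_of_dense`). -/

noncomputable section

namespace Foliated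

/-! ### Division of analytic functions by a linear form -/

section Division

variable {𝕜 : Type*} [NontriviallyNormedField 𝕜] {E : Type*} [NormedAddCommGroup E]
  [NormedSpace 𝕜 E] {F : Type*} [NormedAddCommGroup F] [NormedSpace 𝕜 F]

/-- The formal power series of the quotient by a linear form `ℓ` of a function with power series
`p` that vanishes on `ker ℓ`; here `π` is a projection to `ker ℓ` with kernel spanned by `e`. -/
def divSeries (p : FormalMultilinearSeries 𝕜 E F) (π : E →L[𝕜] E) (e : E) :
    FormalMultilinearSeries 𝕜 E F := fun m =>
  ∑ k : Fin (m + 1), ((p (m + 1)).compContinuousLinearMap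
    (fun j => if j ≤ k then ContinuousLinearMap.id 𝕜 E else π)).curryMid k e

lemma norm_divSeries_le (p : FormalMultilinearSeries 𝕜 E F) (π : E →L[𝕜] E) (e : E) (m : ℕ) :
    ‖divSeries p π e m‖ ≤ (m + 1) * (‖p (m + 1)‖ * (1 + ‖π‖) ^ (m + 1) * ‖e‖) := by
  have h : ∀ k : Fin (m + 1), ‖((p (m + 1)).compContinuousLinearMap
      (fun j => if j ≤ k then ContinuousLinearMap.id 𝕜 E else π)).curryMid k e‖ ≤
      ‖p (m + 1)‖ * (1 + ‖π‖) ^ (m + 1) * ‖e‖ := by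
    intro k
    refine (ContinuousLinearMap.le_opNorm _ _).trans ?_
    rw [ContinuousMultilinearMap.norm_curryMid]
    gcongr
    refine (ContinuousMultilinearMap.norm_compContinuousLinearMap_le _ _).trans ?_
    gcongr
    calc _ ≤ ∏ _j : Fin (m + 1), (1 + ‖π‖) := by
          refine Finset.prod_le_prod (fun _ _ => norm_nonneg _) fun j _ => ?_
          split_ifs
          · exact ContinuousLinearMap.norm_id_le.trans (by linarith [norm_nonneg π])
          · linarith
      _ = _ := by simp
  calc _ ≤ ∑ k : Fin (m + 1), ‖p (m + 1)‖ * (1 + ‖π‖) ^ (m + 1) * ‖e‖ :=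
        norm_sum_le_of_le _ fun k _ => h k
    _ = _ := by simp

lemma radius_divSeries_pos {p : FormalMultilinearSeries 𝕜 E F} (hp : 0 < p.radius)
    (π : E →L[𝕜] E) (e : E) : 0 < (divSeries p π e).radius := by
  obtain ⟨C, r, hC, hr, h⟩ := p.le_mul_pow_of_radius_pos hp
  -- The growth rate of the quotient series: `r` comes from `p`, `1 + ‖π‖` from the projections, and
  -- the 2 absorbs the number `m + 1 ≤ 2 ^ (m + 1)` of summands.
  set a : ℝ := 2 * (r * (1 + ‖π‖)) with ha
  have hπ := norm_nonneg π
  have ha0 : 0 < a := by positivity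
  refine lt_of_lt_of_le (b := ((Real.toNNReal a⁻¹ : NNReal) : ENNReal)) (by simpa using ha0)
    ((divSeries p π e).le_radius_of_bound (C * ‖e‖ * a) fun m => ?_)
  rw [Real.coe_toNNReal _ (by positivity)]
  have h2 : (m + 1 : ℝ) ≤ 2 ^ (m + 1) := by
    exact_mod_cast (Nat.lt_two_pow_self (n := m + 1)).le
  calc _ ≤ ((m + 1) * (‖p (m + 1)‖ * (1 + ‖π‖) ^ (m + 1) * ‖e‖)) * a⁻¹ ^ m := by
        gcongr; exact norm_divSeries_le p π e m
    _ ≤ (2 ^ (m + 1) * (C * r ^ (m + 1) * (1 + ‖π‖) ^ (m + 1) * ‖e‖)) * a⁻¹ ^ m := by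
        gcongr; exact h _
    _ = C * ‖e‖ * (2 * (r * (1 + ‖π‖))) * ((2 * (r * (1 + ‖π‖))) ^ m * a⁻¹ ^ m) := by
        simp only [pow_succ, mul_pow]; ring
    _ = C * ‖e‖ * a := by rw [← mul_pow, mul_inv_cancel₀ ha0.ne', one_pow, mul_one]

/-- A telescoping sum: the arguments `y` are replaced one by one by `π y = y - ℓ y • e`, and the
k-th difference has `ℓ y • e` in slot `k`, `y` before it and `π y` after it. -/
lemma smul_divSeries_apply (p : FormalMultilinearSeries 𝕜 E F) (ℓ : E →L[𝕜] 𝕜) (e : E)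
    (m : ℕ) (y : E) :
    ℓ y • divSeries p (ContinuousLinearMap.id 𝕜 E - ℓ.smulRight e) e m (fun _ => y) =
      p (m + 1) (fun _ => y) - p (m + 1) (fun _ => y - ℓ y • e) := by
  have h := (p (m + 1)).toMultilinearMap.map_piecewise_sub_map_piecewise
    (fun _ => y) (fun _ => y - ℓ y • e) (fun _ => 0) Finset.univ
  simp only [Finset.piecewise_univ, Finset.mem_univ, if_true] at h
  refine Eq.trans ?_ h.symm
  rw [divSeries, sum_apply, Finset.smul_sum]
  refine Finset.sum_congr rfl fun k _ => ?_
  rw [ContinuousMultilinearMap.curryMid_apply,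
    ContinuousMultilinearMap.compContinuousLinearMap_apply]
  have hk : (fun j => if j < k then y else if j = k then y - (y - ℓ y • e) else y - ℓ y • e) =
      Function.update (fun j => if j < k then y else if j = k then e else y - ℓ y • e) k
        (ℓ y • e) := by
    ext j
    by_cases hj : j = k
    · subst hj; simp
    · simp [hj]
  rw [hk, MultilinearMap.map_update_smul]
  congr 1
  refine congrArg (p (m + 1)) (funext fun j => ?_)
  rcases lt_trichotomy j k with hj | hj | hj
  · obtain ⟨i, rfl⟩ := Fin.exists_succAbove_eq hj.ne
    simp [hj, hj.le, hj.ne]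
  · subst hj; simp
  · obtain ⟨i, rfl⟩ := Fin.exists_succAbove_eq hj.ne'
    simp [hj.not_ge, hj.not_gt, hj.ne']

/-- **Division** by a linear form: an analytic function that vanishes on the hyperplane `ℓ = 0` is
the product of `ℓ` and an analytic function. -/
theorem exists_analyticAt_eq_smul [CompleteSpace F] (ℓ : E →L[𝕜] 𝕜) {e : E} (he : ℓ e = 1)
    {h : E → F} {x : E} (hh : AnalyticAt 𝕜 h x) (hx : ℓ x = 0)
    (h0 : ∀ᶠ w in 𝓝 x, ℓ w = 0 → h w = 0) :
    ∃ b : E → F, AnalyticAt 𝕜 b x ∧ ∀ᶠ w in 𝓝 x, h w = ℓ w • b w := by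
  obtain ⟨p, hp⟩ := hh
  set π : E →L[𝕜] E := ContinuousLinearMap.id 𝕜 E - ℓ.smulRight e with hπ
  set q := divSeries p π e with hq
  have hqr : 0 < q.radius := radius_divSeries_pos hp.radius_pos π e
  have hqs := (q.hasFPowerSeriesOnBall hqr).hasFPowerSeriesAt
  refine ⟨fun w => q.sum (w - x), ?_, ?_⟩
  · have : AnalyticAt 𝕜 (fun w => q.sum w) (x - x) := by rw [sub_self]; exact ⟨q, hqs⟩
    exact this.fun_comp (f := fun w => w - x) (analyticAt_id.fun_sub analyticAt_const)
  have hπc : Tendsto (fun w => π (w - x)) (𝓝 x) (𝓝 0) := by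
    have : Continuous fun w => π (w - x) := by fun_prop
    simpa using this.tendsto x
  have hid : Tendsto (fun w => w - x) (𝓝 x) (𝓝 0) := by
    have : Continuous fun w => w - x := by fun_prop
    simpa using this.tendsto x
  have hxπ : Tendsto (fun w => x + π (w - x)) (𝓝 x) (𝓝 x) := by
    simpa using tendsto_const_nhds.add hπc
  filter_upwards [hid.eventually hp.eventually_hasSum, hπc.eventually hp.eventually_hasSum,
    hid.eventually hqs.eventually_hasSum, hxπ.eventually h0] with w h1 h2 h3 h4
  have hlw : ℓ (w - x) = ℓ w := by simp [hx]
  have hπw : π (w - x) = (w - x) - ℓ w • e := by simp [hπ, hx]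
  -- This point is the projection of `w` to the hyperplane. Subtracting the expansion of `h` there
  -- changes nothing and makes every term divisible by `ℓ w`; the terms of degree 0 cancel, whence
  -- the shift of the index by one.
  have h5 : h (x + π (w - x)) = 0 := h4 (by rw [hπw]; simp [hx, he])
  rw [h5] at h2
  have h6 := h1.sub h2
  rw [sub_zero, add_sub_cancel, ← hasSum_nat_add_iff' 1] at h6
  simp only [Finset.range_one, Finset.sum_singleton] at h6
  have e0 : (p 0 fun _ => w - x) - (p 0 fun _ => π (w - x)) = 0 := by
    rw [sub_eq_zero]; exact congrArg (p 0) (Subsingleton.elim _ _)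
  rw [e0, sub_zero] at h6
  rw [zero_add] at h3
  have h7 := h3.const_smul (ℓ w)
  refine h6.unique (h7.congr_fun ?_)
  intro m
  rw [← hlw, smul_divSeries_apply, hπw, hlw]

end Division

/-! ### Analytic vector fields and their components in a chart -/

section Charts

variable {𝕜 : Type*} [RCLike 𝕜] {n : ℕ}
variable {M : Type*} [TopologicalSpace M] [ChartedSpace (Fin n → 𝕜) M]

lemma mdifferentiable_of_mem_maximalAtlas {φ : OpenPartialHomeomorph M (Fin n → 𝕜)}
    (hφ : φ ∈ IsManifold.maximalAtlas 𝓘(𝕜, Fin n → 𝕜) ω M) :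
    φ.MDifferentiable 𝓘(𝕜, Fin n → 𝕜) 𝓘(𝕜, Fin n → 𝕜) :=
  ⟨(contMDiffOn_of_mem_maximalAtlas hφ).mdifferentiableOn (by simp),
    (contMDiffOn_symm_of_mem_maximalAtlas hφ).mdifferentiableOn (by simp)⟩

/-- The components of a vector field in a chart. -/
def chartRep (φ : OpenPartialHomeomorph M (Fin n → 𝕜)) (X : Field 𝕜 n M) (x : M) : Fin n → 𝕜 :=
  mfderiv 𝓘(𝕜, Fin n → 𝕜) 𝓘(𝕜, Fin n → 𝕜) φ x (X x)

/-- The vector field with given components in a chart. -/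
def ofChartRep (φ : OpenPartialHomeomorph M (Fin n → 𝕜)) (v : M → Fin n → 𝕜) : Field 𝕜 n M :=
  fun x => mfderiv 𝓘(𝕜, Fin n → 𝕜) 𝓘(𝕜, Fin n → 𝕜) φ.symm (φ x) (v x : Fin n → 𝕜)

section

variable {φ : OpenPartialHomeomorph M (Fin n → 𝕜)}
  (hφ : φ ∈ IsManifold.maximalAtlas 𝓘(𝕜, Fin n → 𝕜) ω M)

include hφ

lemma chartRep_ofChartRep (v : M → Fin n → 𝕜) {x : M} (hx : x ∈ φ.source) :
    chartRep φ (ofChartRep φ v) x = v x := by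
  have h := (mdifferentiable_of_mem_maximalAtlas hφ).comp_symm_deriv (φ.map_source hx)
  rw [φ.left_inv hx] at h
  exact congrArg (fun L => L (v x)) h

lemma ofChartRep_chartRep (X : Field 𝕜 n M) {x : M} (hx : x ∈ φ.source) :
    ofChartRep φ (chartRep φ X) x = X x :=
  congrArg (fun L => L (X x)) ((mdifferentiable_of_mem_maximalAtlas hφ).symm_comp_deriv hx)

lemma mfderiv_chart_injective {x : M} (hx : x ∈ φ.source) :
    Function.Injective (mfderiv 𝓘(𝕜, Fin n → 𝕜) 𝓘(𝕜, Fin n → 𝕜) φ x) :=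
  (mdifferentiable_of_mem_maximalAtlas hφ).mfderiv_injective hx

lemma chart_symm_isInvertible {y : Fin n → 𝕜} (hy : y ∈ φ.target) :
    (mfderiv 𝓘(𝕜, Fin n → 𝕜) 𝓘(𝕜, Fin n → 𝕜) φ.symm y).IsInvertible :=
  ⟨(mdifferentiable_of_mem_maximalAtlas hφ).symm.mfderiv hy, rfl⟩

lemma chart_isInvertible {x : M} (hx : x ∈ φ.source) :
    (mfderiv 𝓘(𝕜, Fin n → 𝕜) 𝓘(𝕜, Fin n → 𝕜) φ x).IsInvertible :=
  ⟨(mdifferentiable_of_mem_maximalAtlas hφ).mfderiv hx, rfl⟩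

end

variable [IsManifold 𝓘(𝕜, Fin n → 𝕜) ω M]

lemma FunAnalyticAt.eventually {f : M → 𝕜} {p : M} (hf : FunAnalyticAt 𝕜 n f p) :
    ∀ᶠ x in 𝓝 p, FunAnalyticAt 𝕜 n f x :=
  (contMDiffAt_iff_contMDiffAt_nhds (by simp)).1 hf

lemma FieldAnalyticAt.congr {X Y : Field 𝕜 n M} {p : M} (hX : FieldAnalyticAt X p)
    (h : X =ᶠ[𝓝 p] Y) : FieldAnalyticAt Y p :=
  ContMDiffAt.congr_of_eventuallyEq hX (h.mono fun x hx => by simp [hx])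

lemma FieldAnalyticAt.eventually {X : Field 𝕜 n M} {p : M} (hX : FieldAnalyticAt X p) :
    ∀ᶠ x in 𝓝 p, FieldAnalyticAt X x :=
  (contMDiffAt_iff_contMDiffAt_nhds (by simp)).1 hX

lemma FieldAnalyticAt.mdifferentiableAt {X : Field 𝕜 n M} {p : M} (hX : FieldAnalyticAt X p) :
    MDifferentiableAt 𝓘(𝕜, Fin n → 𝕜) (𝓘(𝕜, Fin n → 𝕜)).tangent
      (fun x => (⟨x, X x⟩ : TangentBundle 𝓘(𝕜, Fin n → 𝕜) M)) p :=
  ContMDiffAt.mdifferentiableAt hX (by simp)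

variable {φ : OpenPartialHomeomorph M (Fin n → 𝕜)}
  (hφ : φ ∈ IsManifold.maximalAtlas 𝓘(𝕜, Fin n → 𝕜) ω M)

include hφ

/-- The pull-back of `X` by `φ.symm` is a field on the model space, where analytic sections of the
tangent bundle are just analytic maps. The converse below pulls back by `φ`. -/
lemma FieldAnalyticAt.chartRep {X : Field 𝕜 n M} {p : M} (hX : FieldAnalyticAt X p)
    (hp : p ∈ φ.source) :
    ContMDiffAt 𝓘(𝕜, Fin n → 𝕜) 𝓘(𝕜, Fin n → 𝕜) ω (chartRep φ X) p := by
  have hX' : FieldAnalyticAt X (φ.symm (φ p)) := by rwa [φ.left_inv hp]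
  have h1 := ContMDiffAt.mpullback_vectorField_preimage (I := 𝓘(𝕜, Fin n → 𝕜)) (m := ω) (n := ω)
    hX' (contMDiffAt_symm_of_mem_maximalAtlas hφ (φ.map_source hp))
    (chart_symm_isInvertible hφ (φ.map_source hp)) le_rfl
  have h2 := (contMDiffAt_vectorSpace_iff_contDiffAt.1 h1).contMDiffAt
  have h3 := h2.comp p (contMDiffAt_of_mem_maximalAtlas hφ hp)
  refine h3.congr_of_eventuallyEq ?_
  filter_upwards [φ.open_source.mem_nhds hp] with x hx
  refine ((chart_symm_isInvertible hφ (φ.map_source hx)).inverse_apply_eq.2 ?_).symm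
  exact (congrArg (fun z => (X z : Fin n → 𝕜)) (φ.left_inv hx)).trans
    (ofChartRep_chartRep hφ X hx).symm

lemma fieldAnalyticAt_of_chartRep {X : Field 𝕜 n M} {p : M} (hp : p ∈ φ.source)
    (hX : ContMDiffAt 𝓘(𝕜, Fin n → 𝕜) 𝓘(𝕜, Fin n → 𝕜) ω (chartRep φ X) p) :
    FieldAnalyticAt X p := by
  set V : Field 𝕜 n (Fin n → 𝕜) := fun y => chartRep φ X (φ.symm y) with hV
  have hX' : ContMDiffAt 𝓘(𝕜, Fin n → 𝕜) 𝓘(𝕜, Fin n → 𝕜) ω (chartRep φ X) (φ.symm (φ p)) := by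
    rwa [φ.left_inv hp]
  have h1 : ContMDiffAt 𝓘(𝕜, Fin n → 𝕜) 𝓘(𝕜, Fin n → 𝕜) ω (fun y => chartRep φ X (φ.symm y))
      (φ p) :=
    hX'.comp (φ p) (contMDiffAt_symm_of_mem_maximalAtlas hφ (φ.map_source hp))
  have h2 := (contMDiffAt_vectorSpace_iff_contDiffAt (V := V)).2 h1.contDiffAt
  have h3 := ContMDiffAt.mpullback_vectorField_preimage (I := 𝓘(𝕜, Fin n → 𝕜)) (m := ω) (n := ω)
    h2 (contMDiffAt_of_mem_maximalAtlas hφ hp) (chart_isInvertible hφ hp) le_rfl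
  refine FieldAnalyticAt.congr h3 ?_
  filter_upwards [φ.open_source.mem_nhds hp] with x hx
  refine (chart_isInvertible hφ hx).inverse_apply_eq.2 ?_
  exact congrArg (chartRep φ X) (φ.left_inv hx)

lemma fieldAnalyticAt_ofChartRep {v : M → Fin n → 𝕜} {p : M} (hp : p ∈ φ.source)
    (hv : ContMDiffAt 𝓘(𝕜, Fin n → 𝕜) 𝓘(𝕜, Fin n → 𝕜) ω v p) :
    FieldAnalyticAt (ofChartRep φ v) p :=
  fieldAnalyticAt_of_chartRep hφ hp <| hv.congr_of_eventuallyEq <|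
    Filter.mem_of_superset (φ.open_source.mem_nhds hp) fun _ hx => chartRep_ofChartRep hφ v hx

/-- Linear independence of the values of analytic vector fields is an open condition. -/
lemma eventually_linearIndependent {ι : Type*} [Finite ι] {X : ι → Field 𝕜 n M} {p : M}
    (hp : p ∈ φ.source) (hX : ∀ i, FieldAnalyticAt (X i) p)
    (hli : LinearIndependent 𝕜 fun i => X i p) :
    ∀ᶠ x in 𝓝 p, LinearIndependent 𝕜 fun i => X i x := by
  -- The components in the chart all live in one fixed space, where independence is an open
  -- condition.
  have h1 : LinearIndependent 𝕜 fun i => chartRep φ (X i) p :=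
    hli.map' (mfderiv 𝓘(𝕜, Fin n → 𝕜) 𝓘(𝕜, Fin n → 𝕜) φ p).toLinearMap
      (LinearMap.ker_eq_bot.2 (mfderiv_chart_injective hφ hp))
  have h2 : ContinuousAt (fun x i => chartRep φ (X i) x) p :=
    continuousAt_pi.2 fun i => ((hX i).chartRep hφ hp).continuousAt
  filter_upwards [h2.eventually h1.eventually] with x hx
  exact LinearIndependent.of_comp
    (mfderiv 𝓘(𝕜, Fin n → 𝕜) 𝓘(𝕜, Fin n → 𝕜) φ x).toLinearMap hx

/-- Two analytic vector fields that agree on a dense set agree. -/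
lemma eventuallyEq_of_frequently_eq {X Y : Field 𝕜 n M} {p : M} (hp : p ∈ φ.source)
    (hX : FieldAnalyticAt X p) (hY : FieldAnalyticAt Y p) {s : Set M}
    (hs : ∀ᶠ x in 𝓝 p, x ∈ closure s) (h : ∀ᶠ x in 𝓝 p, x ∈ s → X x = Y x) :
    X =ᶠ[𝓝 p] Y := by
  filter_upwards [hs, hX.eventually, hY.eventually, h.eventually_nhds,
    φ.open_source.mem_nhds hp] with x h1 h2 h3 h4 h5
  refine mfderiv_chart_injective hφ h5 ?_
  change chartRep φ X x = chartRep φ Y x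
  refine tendsto_nhds_unique_of_frequently_eq (h2.chartRep hφ h5).continuousAt
    (h3.chartRep hφ h5).continuousAt ?_
  have h6 := mem_closure_iff_frequently.1 h1
  refine (h6.and_eventually h4).mono fun y hy => ?_
  rw [chartRep, hy.2 hy.1, chartRep]

end Charts

/-! ### Germs of functions and fields, and frames of a distribution -/

section Germs

variable {𝕜 : Type*} [RCLike 𝕜] {n : ℕ}
variable {M : Type*} [TopologicalSpace M] [ChartedSpace (Fin n → 𝕜) M]

/-- The germ at `p` of an analytic function. -/
def stalkOf {p : M} (f : M → 𝕜) (hf : FunAnalyticAt 𝕜 n f p) : Stalk 𝕜 n p := ⟨f, f, hf, rfl⟩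

lemma exists_stalkOf_eq {p : M} (a : Stalk 𝕜 n p) :
    ∃ (f : M → 𝕜) (hf : FunAnalyticAt 𝕜 n f p), a = stalkOf f hf := by
  obtain ⟨_, f, hf, rfl⟩ := a
  exact ⟨f, hf, rfl⟩

lemma stalkOf_eq_zero {p : M} {f : M → 𝕜} {hf : FunAnalyticAt 𝕜 n f p} :
    stalkOf f hf = 0 ↔ ∀ᶠ x in 𝓝 p, f x = 0 := by
  rw [Subtype.ext_iff]
  exact Germ.coe_eq

lemma stalkOf_mem_idealStalk {N : Set M} {p : M} {f : M → 𝕜} {hf : FunAnalyticAt 𝕜 n f p} :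
    stalkOf f hf ∈ idealStalk 𝕜 n N p ↔ ∀ᶠ x in 𝓝 p, x ∈ N → f x = 0 := by
  constructor
  · rintro ⟨g, hg, hg0⟩
    filter_upwards [Germ.coe_eq.1 hg, hg0] with x h1 h2 hx
    rw [h1, h2 hx]
  · exact fun h => ⟨f, rfl, h⟩

lemma fieldGerm_eq_iff {p : M} {X Y : Field 𝕜 n M} :
    fieldGerm p X = fieldGerm p Y ↔ ∀ᶠ x in 𝓝 p, X x = Y x := Germ.coe_eq

lemma FunAnalyticAt.const (p : M) (c : 𝕜) : FunAnalyticAt 𝕜 n (fun _ : M => c) p :=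
  contMDiffAt_const

lemma isUnit_stalkOf {p : M} {f : M → 𝕜} {hf : FunAnalyticAt 𝕜 n f p} (h : f p ≠ 0) :
    IsUnit (stalkOf f hf) := by
  refine IsUnit.of_mul_eq_one (stalkOf (fun x => (f x)⁻¹) (ContMDiffAt.inv₀ hf h)) ?_
  refine Subtype.ext (Germ.coe_eq.2 ?_)
  have h1 : ∀ᶠ x in 𝓝 p, f x ≠ 0 := (ContMDiffAt.continuousAt hf).eventually_ne h
  filter_upwards [h1] with x hx
  exact mul_inv_cancel₀ hx

/-- The ideal of the germs that vanish at `p` is contained in the Jacobson radical of `𝒪_p`. -/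
lemma idealStalk_singleton_le_jacobson (p : M) :
    idealStalk 𝕜 n {p} p ≤ Ideal.jacobson ⊥ := by
  intro a ha
  rw [Ideal.mem_jacobson_bot]
  intro b
  obtain ⟨f, hf, rfl⟩ := exists_stalkOf_eq a
  obtain ⟨g, hg, rfl⟩ := exists_stalkOf_eq b
  have h0 : f p = 0 := (stalkOf_mem_idealStalk.1 ha).self_of_nhds rfl
  have h1 : FunAnalyticAt 𝕜 n (fun x => f x * g x + 1) p :=
    ContMDiffAt.add (ContMDiffAt.mul hf hg) contMDiffAt_const
  exact isUnit_stalkOf (hf := h1) (by simp [h0])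

lemma fieldGerm_sum {ι : Type*} (s : Finset ι) {p : M} (f : ι → M → 𝕜)
    (hf : ∀ i, FunAnalyticAt 𝕜 n (f i) p) (X : ι → Field 𝕜 n M) :
    fieldGerm p (fun x => ∑ i ∈ s, f i x • X i x : Field 𝕜 n M) =
      ∑ i ∈ s, stalkOf (f i) (hf i) • fieldGerm p (X i) := by
  classical
  induction s using Finset.induction_on with
  | empty => rfl
  | insert i s hi ih =>
    rw [Finset.sum_insert hi, ← ih]
    refine fieldGerm_eq_iff.2 (Eventually.of_forall fun x => ?_)
    exact Finset.sum_insert hi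

/-- Turns a relation between germs into an identity on a neighbourhood, which can then be read at
nearby points. -/
lemma mem_span_germs {ι : Type*} [Fintype ι] {p : M} {X : ι → Field 𝕜 n M} {W : Field 𝕜 n M} :
    fieldGerm p W ∈ Submodule.span (Stalk 𝕜 n p) (Set.range fun i => fieldGerm p (X i)) ↔
      ∃ f : ι → M → 𝕜, (∀ i, FunAnalyticAt 𝕜 n (f i) p) ∧
        ∀ᶠ x in 𝓝 p, W x = ∑ i, f i x • X i x := by
  rw [Submodule.mem_span_range_iff_exists_fun]
  constructor
  · rintro ⟨c, hc⟩
    choose f hf hcf using fun i => exists_stalkOf_eq (c i)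
    refine ⟨f, hf, fieldGerm_eq_iff.1 ?_⟩
    rw [← hc]
    refine Eq.trans ?_ (fieldGerm_sum Finset.univ f hf X).symm
    exact Finset.sum_congr rfl fun i _ => by rw [← hcf i]
  · rintro ⟨f, hf, h⟩
    exact ⟨fun i => stalkOf (f i) (hf i),
      (fieldGerm_sum Finset.univ f hf X).symm.trans (fieldGerm_eq_iff.2 h).symm⟩

variable [IsManifold 𝓘(𝕜, Fin n → 𝕜) ω M]

/-- The germ at `p` of an analytic vector field. -/
def derOf {p : M} (X : Field 𝕜 n M) (hX : FieldAnalyticAt X p) : DerStalk 𝕜 n p :=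
  ⟨fieldGerm p X, X, hX, rfl⟩

lemma exists_derOf_eq {p : M} (v : DerStalk 𝕜 n p) :
    ∃ (X : Field 𝕜 n M) (hX : FieldAnalyticAt X p), v = derOf X hX := by
  obtain ⟨_, X, hX, rfl⟩ := v
  exact ⟨X, hX, rfl⟩

lemma derOf_eq_iff {p : M} {X Y : Field 𝕜 n M} {hX : FieldAnalyticAt X p}
    {hY : FieldAnalyticAt Y p} : derOf X hX = derOf Y hY ↔ ∀ᶠ x in 𝓝 p, X x = Y x := by
  rw [Subtype.ext_iff]
  exact fieldGerm_eq_iff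

lemma FieldAnalyticAt.sum {ι : Type*} (s : Finset ι) {p : M} {f : ι → M → 𝕜}
    (hf : ∀ i, FunAnalyticAt 𝕜 n (f i) p) {X : ι → Field 𝕜 n M}
    (hX : ∀ i, FieldAnalyticAt (X i) p) :
    FieldAnalyticAt (fun x => ∑ i ∈ s, f i x • X i x) p := by
  classical
  induction s using Finset.induction_on with
  | empty => exact (Bundle.contMDiff_zeroSection 𝕜
      (TangentSpace 𝓘(𝕜, Fin n → 𝕜) : M → Type _)).contMDiffAt
  | insert i s hi ih =>
    simp only [Finset.sum_insert hi]
    exact ContMDiffAt.add_section (ContMDiffAt.smul_section (hf i) (hX i)) ih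

lemma derOf_sum {ι : Type*} (s : Finset ι) {p : M} {f : ι → M → 𝕜}
    (hf : ∀ i, FunAnalyticAt 𝕜 n (f i) p) {X : ι → Field 𝕜 n M}
    (hX : ∀ i, FieldAnalyticAt (X i) p) :
    derOf (fun x => ∑ i ∈ s, f i x • X i x) (FieldAnalyticAt.sum s hf hX) =
      ∑ i ∈ s, stalkOf (f i) (hf i) • derOf (X i) (hX i) := by
  refine Subtype.ext ?_
  rw [Submodule.coe_sum]
  exact fieldGerm_sum s f hf X

/-- The coordinate vector fields of a chart. -/
def coordField (φ : OpenPartialHomeomorph M (Fin n → 𝕜)) (i : Fin n) : Field 𝕜 n M :=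
  ofChartRep φ fun _ => Pi.single i 1

section

variable {φ : OpenPartialHomeomorph M (Fin n → 𝕜)}
  (hφ : φ ∈ IsManifold.maximalAtlas 𝓘(𝕜, Fin n → 𝕜) ω M)

include hφ

lemma fieldAnalyticAt_coordField {p : M} (hp : p ∈ φ.source) (i : Fin n) :
    FieldAnalyticAt (coordField φ i) p :=
  fieldAnalyticAt_ofChartRep hφ hp contMDiffAt_const

lemma FieldAnalyticAt.chartRep_apply {X : Field 𝕜 n M} {p : M} (hX : FieldAnalyticAt X p)
    (hp : p ∈ φ.source) (i : Fin n) : FunAnalyticAt 𝕜 n (fun x => Foliated.chartRep φ X x i) p :=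
  contMDiffAt_pi_space.1 (hX.chartRep hφ hp) i

omit [IsManifold 𝓘(𝕜, Fin n → 𝕜) ω M] in
lemma eq_sum_coordField (X : Field 𝕜 n M) {x : M} (hx : x ∈ φ.source) :
    X x = ∑ i, chartRep φ X x i • coordField φ i x := by
  refine mfderiv_chart_injective hφ hx ?_
  rw [map_sum]
  have : ∀ i, mfderiv 𝓘(𝕜, Fin n → 𝕜) 𝓘(𝕜, Fin n → 𝕜) φ x (chartRep φ X x i • coordField φ i x) =
      (chartRep φ X x i • Pi.single i (1 : 𝕜) : Fin n → 𝕜) := fun i => by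
    rw [map_smul]
    exact congrArg _ (chartRep_ofChartRep hφ _ hx)
  simp only [this]
  exact pi_eq_sum_univ' (chartRep φ X x)

lemma derOf_eq_sum_coordField {X : Field 𝕜 n M} {p : M} (hX : FieldAnalyticAt X p)
    (hp : p ∈ φ.source) :
    derOf X hX = ∑ i, stalkOf _ (hX.chartRep_apply hφ hp i) •
      derOf (coordField φ i) (fieldAnalyticAt_coordField hφ hp i) := by
  rw [← derOf_sum, derOf_eq_iff]
  filter_upwards [φ.open_source.mem_nhds hp] with x hx
  exact eq_sum_coordField hφ X hx

end

/-- The coordinate fields of a chart are generators. This is the finiteness that Nakayama's lemma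
requires in `span_derOf_eq_top`. -/
lemma derStalk_fg (p : M) : (⊤ : Submodule (Stalk 𝕜 n p) (DerStalk 𝕜 n p)).FG := by
  have hφ := IsManifold.chart_mem_maximalAtlas (I := 𝓘(𝕜, Fin n → 𝕜)) (n := ω) p
  classical
  refine ⟨Finset.univ.image fun i =>
    derOf (coordField _ i) (fieldAnalyticAt_coordField hφ (mem_chart_source _ p) i), ?_⟩
  rw [eq_top_iff]
  intro v _
  obtain ⟨X, hX, rfl⟩ := exists_derOf_eq v
  rw [derOf_eq_sum_coordField hφ hX (mem_chart_source _ p)]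
  exact Submodule.sum_mem _ fun i _ => Submodule.smul_mem _ _ (Submodule.subset_span (by simp))

/-- An analytic vector field that vanishes at `p` has a germ in `𝔪_p Der_{M,p}`. -/
lemma derOf_mem_smul_top {p : M} {X : Field 𝕜 n M} (hX : FieldAnalyticAt X p) (h0 : X p = 0) :
    derOf X hX ∈ idealStalk 𝕜 n {p} p • (⊤ : Submodule (Stalk 𝕜 n p) (DerStalk 𝕜 n p)) := by
  have hφ := IsManifold.chart_mem_maximalAtlas (I := 𝓘(𝕜, Fin n → 𝕜)) (n := ω) p
  rw [derOf_eq_sum_coordField hφ hX (mem_chart_source _ p)]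
  refine Submodule.sum_mem _ fun i _ => Submodule.smul_mem_smul ?_ trivial
  refine stalkOf_mem_idealStalk.2 (Eventually.of_forall ?_)
  rintro _ rfl
  rw [chartRep, h0, map_zero]
  rfl

/-- If the value at `p` of `X` is a combination of the values of the `Z i`, then the germ of `X`
is congruent modulo `𝔪_p Der_{M,p}` to a combination of the germs of the `Z i`. -/
lemma exists_sub_mem_smul_top {ι : Type*} [Fintype ι] {p : M} {Z : ι → Field 𝕜 n M}
    (hZ : ∀ i, FieldAnalyticAt (Z i) p) {X : Field 𝕜 n M} (hX : FieldAnalyticAt X p)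
    (h : X p ∈ Submodule.span 𝕜 (Set.range fun i => Z i p)) :
    ∃ v ∈ Submodule.span (Stalk 𝕜 n p) (Set.range fun i => derOf (Z i) (hZ i)),
      derOf X hX - v ∈
        idealStalk 𝕜 n {p} p • (⊤ : Submodule (Stalk 𝕜 n p) (DerStalk 𝕜 n p)) := by
  obtain ⟨c, hc⟩ := (Submodule.mem_span_range_iff_exists_fun 𝕜).1 h
  have hca : ∀ i, FunAnalyticAt 𝕜 n (fun _ : M => c i) p := fun i => FunAnalyticAt.const p _
  have hs := FieldAnalyticAt.sum Finset.univ hca hZ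
  refine ⟨derOf _ hs, ?_, ?_⟩
  · rw [derOf_sum Finset.univ hca hZ]
    exact Submodule.sum_mem _ fun i _ => Submodule.smul_mem _ _ (Submodule.subset_span ⟨i, rfl⟩)
  · have hd : FieldAnalyticAt (fun x => X x - ∑ i, c i • Z i x) p := ContMDiffAt.sub_section hX hs
    have : derOf X hX - derOf _ hs = derOf _ hd := rfl
    rw [this]
    exact derOf_mem_smul_top hd (sub_eq_zero.2 hc.symm)

lemma StalkFamily.mem_iff {θ : StalkFamily 𝕜 n M} {p : M} {X : Field 𝕜 n M} :
    θ.Mem p X ↔ fieldGerm p X ∈ (θ p).map (DerStalk 𝕜 n p).subtype :=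
  Iff.rfl

lemma StalkFamily.mem_derOf {θ : StalkFamily 𝕜 n M} {p : M} {X : Field 𝕜 n M}
    (hX : FieldAnalyticAt X p) : derOf X hX ∈ θ p ↔ θ.Mem p X := by
  constructor
  · exact fun h => ⟨_, h, rfl⟩
  · rintro ⟨v, hv, h⟩
    rwa [show derOf X hX = v from Subtype.ext h.symm]

lemma StalkFamily.Mem.analyticAt {θ : StalkFamily 𝕜 n M} {p : M} {X : Field 𝕜 n M}
    (h : θ.Mem p X) : FieldAnalyticAt X p := by
  obtain ⟨v, -, hv⟩ := h
  obtain ⟨Y, hY, rfl⟩ := exists_derOf_eq v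
  exact hY.congr (fieldGerm_eq_iff.1 hv)

/-- The vector fields `X i` form a frame of `θ` near `p`: they generate `θ` near `p` and have
linearly independent values. -/
structure IsFrameAt {ι : Type*} (θ : StalkFamily 𝕜 n M) (p : M) (X : ι → Field 𝕜 n M) :
    Prop where
  analyticAt : ∀ i, FieldAnalyticAt (X i) p
  linearIndependent : LinearIndependent 𝕜 fun i => X i p
  generate : ∀ᶠ q in 𝓝 p, (θ q).map (DerStalk 𝕜 n q).subtype =
    Submodule.span (Stalk 𝕜 n q) (Set.range fun i => fieldGerm q (X i))

lemma IsFrameAt.mem_iff {ι : Type*} [Fintype ι] {θ : StalkFamily 𝕜 n M} {p : M}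
    {X : ι → Field 𝕜 n M} (h : IsFrameAt θ p X) {W : Field 𝕜 n M} :
    θ.Mem p W ↔ ∃ f : ι → M → 𝕜, (∀ i, FunAnalyticAt 𝕜 n (f i) p) ∧
        ∀ᶠ x in 𝓝 p, W x = ∑ i, f i x • X i x := by
  rw [StalkFamily.mem_iff, h.generate.self_of_nhds, mem_span_germs]

end Germs

/-! ### Modules with free quotients -/

section Algebra

/-- The quotient of a module with a finite basis by the span of part of the basis is free. -/
lemma free_quotient_span_inl {R V ι κ : Type*} [CommRing R] [AddCommGroup V] [Module R V]
    (b : Module.Basis (ι ⊕ κ) R V) :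
    Module.Free R (V ⧸ Submodule.span R (Set.range fun i => b (Sum.inl i))) := by
  -- The coordinates indexed by `κ`: a surjection to a free module whose kernel is the span in
  -- question.
  set f : V →ₗ[R] (κ →₀ R) :=
    (Finsupp.lcomapDomain Sum.inr Sum.inr_injective).comp b.repr.toLinearMap with hf
  have hsurj : Function.Surjective f := by
    intro g
    refine ⟨b.repr.symm (g.mapDomain Sum.inr), ?_⟩
    ext k
    change b.repr (b.repr.symm (g.mapDomain Sum.inr)) (Sum.inr k) = g k
    rw [LinearEquiv.apply_symm_apply, Finsupp.mapDomain_apply Sum.inr_injective]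
  have hker : LinearMap.ker f = Submodule.span R (Set.range fun i => b (Sum.inl i)) := by
    ext v
    rw [show (Set.range fun i => b (Sum.inl i)) = b '' Set.range Sum.inl by
      rw [← Set.range_comp]; rfl, b.mem_span_image, LinearMap.mem_ker, Finsupp.ext_iff]
    constructor
    · intro h x hx
      rcases x with i | k
      · exact ⟨i, rfl⟩
      · exact absurd (h k) (Finsupp.mem_support_iff (f := b.repr v).1 hx)
    · intro h k
      by_contra hk
      obtain ⟨i, hi⟩ := h (show Sum.inr k ∈ ((b.repr v).support : Set (ι ⊕ κ)) from
        Finsupp.mem_support_iff.2 hk)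
      cases hi
  rw [← hker]
  exact Module.Free.of_equiv (f.quotKerEquivOfSurjective hsurj).symm

/-- A submodule with free quotient is compatible with multiplication by ideals. -/
lemma mem_smul_of_mem_smul_top {R V : Type*} [CommRing R] [AddCommGroup V] [Module R V]
    {N : Submodule R V} [Module.Free R (V ⧸ N)] {I : Ideal R} {v : V} (hv : v ∈ N)
    (hI : v ∈ I • (⊤ : Submodule R V)) : v ∈ I • N := by
  obtain ⟨s, hs⟩ := Module.projective_lifting_property N.mkQ LinearMap.id N.mkQ_surjective
  -- The retraction of `V` to `N` defined by the splitting `s`. It fixes `v` and maps `I • ⊤` into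
  -- `I • N`.
  set ρ : V →ₗ[R] V := LinearMap.id - s.comp N.mkQ with hρ
  have h1 : ρ v = v := by
    simp [hρ, (Submodule.Quotient.mk_eq_zero N).2 hv]
  have h2 : Submodule.map ρ ⊤ ≤ N := by
    rintro _ ⟨w, -, rfl⟩
    rw [← Submodule.Quotient.mk_eq_zero, ← Submodule.mkQ_apply]
    have : N.mkQ (s (N.mkQ w)) = N.mkQ w := congrArg (fun L => L (N.mkQ w)) hs
    rw [hρ, LinearMap.sub_apply, map_sub, LinearMap.comp_apply, this, LinearMap.id_apply,
      sub_self]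
  have h3 := Submodule.mem_map_of_mem (f := ρ) hI
  rw [Submodule.map_smul'', h1] at h3
  exact Submodule.smul_mono le_rfl h2 h3

end Algebra

/-! ### Regular distributions and local frames -/

section Frames

variable {𝕜 : Type*} [RCLike 𝕜] {n : ℕ}
variable {M : Type*} [TopologicalSpace M] [ChartedSpace (Fin n → 𝕜) M]
  [IsManifold 𝓘(𝕜, Fin n → 𝕜) ω M]

lemma IsCoherent.stalk_fg {θ : StalkFamily 𝕜 n M} (h : IsCoherent θ) (p : M) : (θ p).FG := by
  obtain ⟨U, -, hpU, r, G, hG⟩ := h p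
  refine Submodule.fg_of_fg_map_injective (DerStalk 𝕜 n p).subtype Subtype.val_injective ?_
  rw [hG p hpU]
  exact Submodule.fg_span (Set.finite_range _)

/-- Membership of a vector field in the span of analytic vector fields is an open condition. -/
lemma eventually_mem_span_germs {ι : Type*} [Fintype ι] {p : M} {X : ι → Field 𝕜 n M}
    {W : Field 𝕜 n M}
    (h : fieldGerm p W ∈ Submodule.span (Stalk 𝕜 n p) (Set.range fun i => fieldGerm p (X i))) :
    ∀ᶠ q in 𝓝 p,
      fieldGerm q W ∈ Submodule.span (Stalk 𝕜 n q) (Set.range fun i => fieldGerm q (X i)) := by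
  obtain ⟨f, hf, hW⟩ := mem_span_germs.1 h
  filter_upwards [eventually_all.2 fun i => (hf i).eventually, hW.eventually_nhds] with q h1 h2
  exact mem_span_germs.2 ⟨f, h1, h2⟩

/-- A regular involutive singular distribution has a frame near every point. -/
theorem IsSingularDistribution.exists_isFrameAt {θ : StalkFamily 𝕜 n M} {d : ℕ}
    (h : IsSingularDistribution θ d) (hreg : IsRegular θ) (p : M) :
    ∃ X : Fin d → Field 𝕜 n M, IsFrameAt θ p X := by
  have hp : p ∉ singularSet θ := by rw [hreg]; exact Set.notMem_empty p
  have hd := h.leafDim p hp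
  have hfree : Module.Free (Stalk 𝕜 n p) (DerStalk 𝕜 n p ⧸ θ p) := not_not.1 hp
  have : FiniteDimensional 𝕜 (TangentSpace 𝓘(𝕜, Fin n → 𝕜) p) :=
    inferInstanceAs (FiniteDimensional 𝕜 (Fin n → 𝕜))
  -- The basis is chosen among the values themselves, so that each vector is the value of an element
  -- of `θ_p`.
  obtain ⟨f, hf, hfs, hfi⟩ := Submodule.exists_fun_fin_finrank_span_eq 𝕜
    {v : TangentSpace 𝓘(𝕜, Fin n → 𝕜) p | ∃ X : Field 𝕜 n M, θ.Mem p X ∧ X p = v}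
  change Module.finrank 𝕜 (Submodule.span 𝕜 _) = d at hd
  subst hd
  choose X hXm hXp using hf
  have hXa : ∀ i, FieldAnalyticAt (X i) p := fun i => (hXm i).analyticAt
  have hfX : (fun i => X i p) = f := funext hXp
  -- Nakayama's lemma. Modulo the span of the `X i`, an element of `θ_p` vanishes at `p`, so it lies
  -- in `θ_p ∩ 𝔪_p Der_p`; freeness of the quotient places it in `𝔪_p θ_p`.
  have hle : θ p ≤ Submodule.span (Stalk 𝕜 n p) (Set.range fun i => derOf (X i) (hXa i)) := by
    refine Submodule.le_of_le_smul_of_le_jacobson_bot (h.coherent.stalk_fg p)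
      (idealStalk_singleton_le_jacobson p) fun v hv => ?_
    obtain ⟨W, hW, rfl⟩ := exists_derOf_eq v
    obtain ⟨u, hu, hu'⟩ := exists_sub_mem_smul_top hXa hW (by
      rw [hfX, hfs]
      exact Submodule.subset_span ⟨W, (StalkFamily.mem_derOf hW).1 hv, rfl⟩)
    rw [← sub_add_cancel (derOf W hW) u, add_comm]
    refine Submodule.add_mem_sup hu (mem_smul_of_mem_smul_top ?_ hu')
    refine Submodule.sub_mem _ hv (Submodule.span_le.2 ?_ hu)
    rintro _ ⟨i, rfl⟩
    exact (StalkFamily.mem_derOf _).2 (hXm i)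
  have hspan : (θ p).map (DerStalk 𝕜 n p).subtype =
      Submodule.span (Stalk 𝕜 n p) (Set.range fun i => fieldGerm p (X i)) := by
    refine le_antisymm ((Submodule.map_mono hle).trans ?_) (Submodule.span_le.2 ?_)
    · rw [Submodule.map_span, ← Set.range_comp]
      rfl
    · rintro _ ⟨i, rfl⟩
      exact hXm i
  refine ⟨X, hXa, by rwa [hfX], ?_⟩
  -- The coherent generators `G k` and the fields `X i` have the same span at `p`. The finitely many
  -- relations that express each family in the other persist near `p`.
  obtain ⟨U, hU, hpU, r, G, hG⟩ := h.coherent p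
  have hG' : ∀ k, ∀ᶠ q in 𝓝 p, fieldGerm q (G k) ∈
      Submodule.span (Stalk 𝕜 n q) (Set.range fun i => fieldGerm q (X i)) := fun k =>
    eventually_mem_span_germs (by
      rw [← hspan, hG p hpU]; exact Submodule.subset_span ⟨k, rfl⟩)
  have hX' : ∀ i, ∀ᶠ q in 𝓝 p, fieldGerm q (X i) ∈
      Submodule.span (Stalk 𝕜 n q) (Set.range fun k => fieldGerm q (G k)) := fun i =>
    eventually_mem_span_germs (by
      rw [← hG p hpU, hspan]; exact Submodule.subset_span ⟨i, rfl⟩)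
  filter_upwards [hU.mem_nhds hpU, eventually_all.2 hG', eventually_all.2 hX'] with q h1 h2 h3
  rw [hG q h1]
  refine le_antisymm (Submodule.span_le.2 ?_) (Submodule.span_le.2 ?_)
  · rintro _ ⟨k, rfl⟩; exact h2 k
  · rintro _ ⟨i, rfl⟩; exact h3 i

/-- Analytic vector fields with independent values at `p` can be completed to analytic vector
fields whose values at `p` form a basis of the tangent space. -/
lemma exists_completion {ι : Type*} {p : M} {X : ι → Field 𝕜 n M}
    (hX : ∀ i, FieldAnalyticAt (X i) p) (hli : LinearIndependent 𝕜 fun i => X i p) :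
    ∃ (r : ℕ) (Z : ι ⊕ Fin r → Field 𝕜 n M), (∀ i, Z (Sum.inl i) = X i) ∧
      (∀ s, FieldAnalyticAt (Z s) p) ∧ (LinearIndependent 𝕜 fun s => Z s p) ∧
      Submodule.span 𝕜 (Set.range fun s => Z s p) = ⊤ := by
  have hφ := IsManifold.chart_mem_maximalAtlas (I := 𝓘(𝕜, Fin n → 𝕜)) (n := ω) p
  have hps := mem_chart_source (Fin n → 𝕜) p
  have : FiniteDimensional 𝕜 (TangentSpace 𝓘(𝕜, Fin n → 𝕜) p) :=
    inferInstanceAs (FiniteDimensional 𝕜 (Fin n → 𝕜))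
  obtain ⟨K, hK⟩ := Submodule.exists_isCompl (Submodule.span 𝕜 (Set.range fun i => X i p))
  set c := Module.finBasis 𝕜 K
  set r := Module.finrank 𝕜 K
  -- Fields with constant components in the chart, chosen so that `Y k` takes the value `c k` at
  -- `p`.
  set Y : Fin r → Field 𝕜 n M := fun k => ofChartRep (chartAt (Fin n → 𝕜) p) fun _ =>
    mfderiv 𝓘(𝕜, Fin n → 𝕜) 𝓘(𝕜, Fin n → 𝕜) (chartAt (Fin n → 𝕜) p) p (c k) with hYdef
  have hYp : ∀ k, Y k p = c k := fun k =>
    mfderiv_chart_injective hφ hps (chartRep_ofChartRep hφ _ hps)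
  have hcs : Submodule.span 𝕜
      (Set.range fun k => (c k : TangentSpace 𝓘(𝕜, Fin n → 𝕜) p)) = K := by
    rw [show (Set.range fun k => (c k : TangentSpace 𝓘(𝕜, Fin n → 𝕜) p)) =
      K.subtype '' Set.range c by rw [← Set.range_comp]; rfl, ← Submodule.map_span, c.span_eq,
      Submodule.map_subtype_top]
  have hZp : (fun s => (Sum.elim X Y s : Field 𝕜 n M) p) = Sum.elim (fun i => X i p)
      (fun k => (c k : TangentSpace 𝓘(𝕜, Fin n → 𝕜) p)) := by
    funext s; rcases s with i | k
    exacts [rfl, hYp k]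
  refine ⟨r, Sum.elim X Y, fun _ => rfl, ?_, ?_, ?_⟩
  · rintro (i | k)
    exacts [hX i, fieldAnalyticAt_ofChartRep hφ hps contMDiffAt_const]
  · rw [hZp]
    refine hli.sum_type (c.linearIndependent.map' K.subtype K.ker_subtype) ?_
    have := hK.disjoint
    rw [← hcs] at this
    exact this
  · rw [hZp, Set.Sum.elim_range, Submodule.span_union, hcs]
    exact hK.sup_eq_top

/-- Analytic vector fields whose values at `p` span the tangent space generate `Der_{M,p}`. -/
lemma span_derOf_eq_top {ι : Type*} [Fintype ι] {p : M} {Z : ι → Field 𝕜 n M}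
    (hZ : ∀ s, FieldAnalyticAt (Z s) p)
    (hs : Submodule.span 𝕜 (Set.range fun s => Z s p) = ⊤) :
    ⊤ ≤ Submodule.span (Stalk 𝕜 n p) (Set.range fun s => derOf (Z s) (hZ s)) := by
  refine Submodule.le_of_le_smul_of_le_jacobson_bot (derStalk_fg p)
    (idealStalk_singleton_le_jacobson p) fun v _ => ?_
  obtain ⟨W, hW, rfl⟩ := exists_derOf_eq v
  obtain ⟨u, hu, hu'⟩ := exists_sub_mem_smul_top hZ hW (by rw [hs]; trivial)
  rw [← sub_add_cancel (derOf W hW) u, add_comm]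
  exact Submodule.add_mem_sup hu hu'

/-- A relation between the germs holds pointwise near `p`, where the values are still independent,
so its coefficients vanish near `p`. -/
lemma linearIndependent_derOf {ι : Type*} [Fintype ι] {p : M} {Z : ι → Field 𝕜 n M}
    (hZ : ∀ s, FieldAnalyticAt (Z s) p) (hli : LinearIndependent 𝕜 fun s => Z s p) :
    LinearIndependent (Stalk 𝕜 n p) fun s => derOf (Z s) (hZ s) := by
  have hφ := IsManifold.chart_mem_maximalAtlas (I := 𝓘(𝕜, Fin n → 𝕜)) (n := ω) p
  rw [Fintype.linearIndependent_iff]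
  intro g hg
  choose f hf hgf using fun s => exists_stalkOf_eq (g s)
  simp only [hgf] at hg
  rw [← derOf_sum Finset.univ hf hZ] at hg
  have h0 : ∀ᶠ x in 𝓝 p, ∑ s, f s x • Z s x = 0 :=
    (fieldGerm_eq_iff (Y := fun _ => 0)).1 (congrArg Subtype.val hg)
  intro s
  rw [hgf, stalkOf_eq_zero]
  filter_upwards [h0, eventually_linearIndependent hφ (mem_chart_source _ p) hZ hli] with x h1 h2
  exact Fintype.linearIndependent_iff.1 h2 (fun s => f s x) h1 s

/-- A completion of the frame to a basis of the tangent space yields a basis of `Der_p`, part of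
which spans `θ_p`. -/
lemma IsFrameAt.free {ι : Type*} [Fintype ι] {θ : StalkFamily 𝕜 n M} {p : M}
    {X : ι → Field 𝕜 n M} (h : IsFrameAt θ p X) :
    Module.Free (Stalk 𝕜 n p) (DerStalk 𝕜 n p ⧸ θ p) := by
  obtain ⟨r, Z, hZX, hZ, hli, hsp⟩ := exists_completion h.analyticAt h.linearIndependent
  set b := Module.Basis.mk (linearIndependent_derOf hZ hli) (span_derOf_eq_top hZ hsp) with hbdef
  have hb : ∀ i, b (Sum.inl i) = derOf (X i) (h.analyticAt i) := by
    intro i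
    rw [hbdef, Module.Basis.mk_apply]
    simp only [hZX]
  have : θ p = Submodule.span (Stalk 𝕜 n p) (Set.range fun i => b (Sum.inl i)) := by
    refine Submodule.map_injective_of_injective (f := (DerStalk 𝕜 n p).subtype)
      Subtype.val_injective ?_
    rw [h.generate.self_of_nhds, Submodule.map_span, ← Set.range_comp]
    simp only [hb, Function.comp_def]
    rfl
  rw [this]
  exact free_quotient_span_inl b

lemma IsFrameAt.values_eq {ι : Type*} [Fintype ι] {θ : StalkFamily 𝕜 n M} {p : M}
    {X : ι → Field 𝕜 n M} (h : IsFrameAt θ p X) :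
    values θ p = Submodule.span 𝕜 (Set.range fun i => X i p) := by
  refine le_antisymm (Submodule.span_le.2 ?_) (Submodule.span_le.2 ?_)
  · rintro _ ⟨W, hW, rfl⟩
    obtain ⟨f, -, hf⟩ := h.mem_iff.1 hW
    rw [SetLike.mem_coe, hf.self_of_nhds]
    exact Submodule.sum_mem _ fun i _ => Submodule.smul_mem _ _ (Submodule.subset_span ⟨i, rfl⟩)
  · rintro _ ⟨i, rfl⟩
    refine Submodule.subset_span ⟨X i, ?_, rfl⟩
    rw [StalkFamily.mem_iff, h.generate.self_of_nhds]
    exact Submodule.subset_span ⟨i, rfl⟩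

lemma isCoherent_of_isFrameAt {θ : StalkFamily 𝕜 n M} {d : ℕ}
    (h : ∀ p, ∃ X : Fin d → Field 𝕜 n M, IsFrameAt θ p X) : IsCoherent θ := by
  intro p
  obtain ⟨X, hX⟩ := h p
  obtain ⟨U, hU, hUo, hp⟩ := eventually_nhds_iff.1 hX.generate
  exact ⟨U, hUo, hp, d, X, hU⟩

lemma isRegular_of_isFrameAt {θ : StalkFamily 𝕜 n M} {d : ℕ}
    (h : ∀ p, ∃ X : Fin d → Field 𝕜 n M, IsFrameAt θ p X) : IsRegular θ := by
  refine Set.eq_empty_of_forall_notMem fun p hp => hp ?_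
  obtain ⟨X, hX⟩ := h p
  exact hX.free

lemma hasLeafDim_of_isFrameAt {θ : StalkFamily 𝕜 n M} {d : ℕ}
    (h : ∀ p, ∃ X : Fin d → Field 𝕜 n M, IsFrameAt θ p X) : HasLeafDim θ d := by
  intro p _
  obtain ⟨X, hX⟩ := h p
  rw [hX.values_eq, finrank_span_eq_card hX.linearIndependent, Fintype.card_fin]

/-- An analytic vector field whose values are, on a dense set, combinations of the values of
independent analytic vector fields is a combination of these with analytic coefficients. -/
lemma mem_span_germs_of_dense {ι : Type*} [Fintype ι] {p : M} {X : ι → Field 𝕜 n M}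
    (hX : ∀ i, FieldAnalyticAt (X i) p) (hli : LinearIndependent 𝕜 fun i => X i p)
    {W : Field 𝕜 n M} (hW : FieldAnalyticAt W p) {s : Set M}
    (hs : ∀ᶠ x in 𝓝 p, x ∈ closure s)
    (h : ∀ᶠ x in 𝓝 p, x ∈ s → W x ∈ Submodule.span 𝕜 (Set.range fun i => X i x)) :
    fieldGerm p W ∈ Submodule.span (Stalk 𝕜 n p) (Set.range fun i => fieldGerm p (X i)) := by
  have hφ := IsManifold.chart_mem_maximalAtlas (I := 𝓘(𝕜, Fin n → 𝕜)) (n := ω) p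
  obtain ⟨r, Z, hZX, hZ, hZli, hsp⟩ := exists_completion hX hli
  have h1 : fieldGerm p W ∈
      Submodule.span (Stalk 𝕜 n p) (Set.range fun s => fieldGerm p (Z s)) := by
    have h2 := Submodule.mem_map_of_mem (f := (DerStalk 𝕜 n p).subtype)
      (span_derOf_eq_top hZ hsp (Submodule.mem_top (x := derOf W hW)))
    rw [Submodule.map_span, ← Set.range_comp] at h2
    exact h2
  obtain ⟨f, hf, hWf⟩ := mem_span_germs.1 h1
  -- The coefficients of the complementary fields vanish on `s` by independence, and then near `p`
  -- by continuity and density.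
  have h3 : ∀ᶠ x in 𝓝 p, x ∈ s → ∀ k, f (Sum.inr k) x = 0 := by
    filter_upwards [h, hWf, eventually_linearIndependent hφ (mem_chart_source _ p) hZ hZli]
      with x hx1 hx2 hx3 hxs k
    obtain ⟨c, hc⟩ := (Submodule.mem_span_range_iff_exists_fun 𝕜).1 (hx1 hxs)
    refine Fintype.linearIndependent_iff.1 hx3
      (Sum.elim (fun i => f (Sum.inl i) x - c i) fun k => f (Sum.inr k) x) ?_ (Sum.inr k)
    rw [Fintype.sum_sum_type] at hx2 ⊢
    simp only [Sum.elim_inl, Sum.elim_inr, sub_smul, Finset.sum_sub_distrib]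
    rw [sub_add_eq_add_sub, ← hx2]
    simp only [hZX]
    rw [hc, sub_self]
  have h4 : ∀ᶠ x in 𝓝 p, ∀ k, f (Sum.inr k) x = 0 := by
    filter_upwards [hs, h3.eventually_nhds, eventually_all.2 fun k => (hf k).eventually]
      with x hx1 hx2 hx3 k
    refine tendsto_nhds_unique_of_frequently_eq (ContMDiffAt.continuousAt (hx3 _))
      continuousAt_const ?_
    exact ((mem_closure_iff_frequently.1 hx1).and_eventually hx2).mono fun y hy => hy.2 hy.1 k
  refine mem_span_germs.2 ⟨fun i => f (Sum.inl i), fun i => hf _, ?_⟩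
  filter_upwards [hWf, h4] with x hx1 hx2
  rw [hx1, Fintype.sum_sum_type]
  simp [hx2, hZX]

end Frames

/-! ### Generators of the adapted analytic strict transform -/

section Transform

variable {𝕜 : Type*} [RCLike 𝕜] {n : ℕ}
variable {M : Type*} [TopologicalSpace M] [ChartedSpace (Fin n → 𝕜) M]
  [IsManifold 𝓘(𝕜, Fin n → 𝕜) ω M]
variable {M' : Type*} [TopologicalSpace M'] [ChartedSpace (Fin n → 𝕜) M']
  [IsManifold 𝓘(𝕜, Fin n → 𝕜) ω M']
variable {σ : M' → M} {C : Set M}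

/-- The vector field `Y` is the pull-back of `X` at `y`. -/
def RelatedAt (σ : M' → M) (Y : Field 𝕜 n M') (X : Field 𝕜 n M) (y : M') : Prop :=
  mfderiv 𝓘(𝕜, Fin n → 𝕜) 𝓘(𝕜, Fin n → 𝕜) σ y (Y y) = X (σ y)

omit [IsManifold 𝓘(𝕜, Fin n → 𝕜) ω M] [IsManifold 𝓘(𝕜, Fin n → 𝕜) ω M'] in
lemma RelatedAt.sum {ι : Type*} [Fintype ι] {X : ι → Field 𝕜 n M} {Y : ι → Field 𝕜 n M'} {y : M'}
    (h : ∀ i, RelatedAt σ (Y i) (X i) y) (a : ι → M → 𝕜) :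
    RelatedAt σ (fun z => ∑ i, a i (σ z) • Y i z) (fun x => ∑ i, a i x • X i x) y := by
  refine (map_sum _ _ _).trans (Finset.sum_congr rfl fun i _ => ?_)
  rw [map_smul, h i]

omit [IsManifold 𝓘(𝕜, Fin n → 𝕜) ω M] in
lemma Preserves.congr {X Y : Field 𝕜 n M} {N : Set M} {p : M} (hX : Preserves X N p)
    (h : ∀ᶠ x in 𝓝 p, X x = Y x) : Preserves Y N p := by
  intro g hg hg0
  filter_upwards [h, hX g hg hg0] with x h1 h2 hx
  rw [act, ← h1]
  exact h2 hx

lemma derOf_mem_logDer {X : Field 𝕜 n M} {N : Set M} {p : M} (hX : FieldAnalyticAt X p)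
    (h : Preserves X N p) : derOf X hX ∈ logDer 𝕜 n N p :=
  fun _ hY => h.congr (fieldGerm_eq_iff.1 hY)

omit [IsManifold 𝓘(𝕜, Fin n → 𝕜) ω M] in
lemma isPullback_zeta {F : Set M'} {q : M'} {X : Field 𝕜 n M} {Y : Field 𝕜 n M'}
    (hY : FieldAnalyticAt Y q) (h : ∀ᶠ y in 𝓝 q, RelatedAt σ Y X y) :
    IsPullback σ F q X (zeta 𝕜 n F q (derOf Y hY)) := by
  rintro ⟨f, hf⟩
  obtain ⟨g, hg, rfl⟩ := exists_stalkOf_eq f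
  refine ⟨g, fun y => g y • Y y, rfl, rfl, ?_⟩
  filter_upwards [h] with y hy
  rw [map_smul, hy]

variable {q : M'} (hdense : ∀ᶠ y in 𝓝 q, y ∈ closure (σ ⁻¹' C)ᶜ)

include hdense

omit [TopologicalSpace M] [ChartedSpace (Fin n → 𝕜) M] [IsManifold 𝓘(𝕜, Fin n → 𝕜) ω M] in
lemma eventuallyEq_of_eq_off {V W : Field 𝕜 n M'} (hV : FieldAnalyticAt V q)
    (hW : FieldAnalyticAt W q) (h : ∀ᶠ y in 𝓝 q, y ∉ σ ⁻¹' C → V y = W y) :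
    ∀ᶠ y in 𝓝 q, V y = W y :=
  eventuallyEq_of_frequently_eq
    (IsManifold.chart_mem_maximalAtlas (I := 𝓘(𝕜, Fin n → 𝕜)) (n := ω) q) (mem_chart_source _ q)
    hV hW hdense h

variable {f : M' → 𝕜} (hf : FunAnalyticAt 𝕜 n f q) (hf0 : ∀ᶠ y in 𝓝 q, y ∈ σ ⁻¹' C ↔ f y = 0)

include hf hf0

omit [TopologicalSpace M] [ChartedSpace (Fin n → 𝕜) M] [IsManifold 𝓘(𝕜, Fin n → 𝕜) ω M] in
-- Evaluation at the local equation `f` of the divisor gives `f V = f W`, so `V` and `W` agree where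
-- `f ≠ 0`, which is a dense set.
lemma zeta_injective : Function.Injective (zeta 𝕜 n (σ ⁻¹' C) q) := by
  intro v w h
  obtain ⟨V, hV, rfl⟩ := exists_derOf_eq v
  obtain ⟨W, hW, rfl⟩ := exists_derOf_eq w
  have hfm : stalkOf f hf ∈ idealStalk 𝕜 n (σ ⁻¹' C) q :=
    stalkOf_mem_idealStalk.2 (hf0.mono fun y hy => hy.1)
  have h1 : stalkOf f hf • derOf V hV = stalkOf f hf • derOf W hW :=
    congrArg (fun Φ : BlDer 𝕜 n (σ ⁻¹' C) q => Φ ⟨_, hfm⟩) h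
  have h2 : ∀ᶠ y in 𝓝 q, f y • V y = f y • W y :=
    (fieldGerm_eq_iff (X := fun y => f y • V y) (Y := fun y => f y • W y)).1
      (congrArg Subtype.val h1)
  refine derOf_eq_iff.2 (eventuallyEq_of_eq_off hdense hV hW ?_)
  filter_upwards [h2, hf0] with y h3 h4 hy
  exact smul_right_injective _ (fun h0 => hy (h4.2 h0)) h3

omit [IsManifold 𝓘(𝕜, Fin n → 𝕜) ω M] hf hf0 in
-- Uniqueness of the pull-back: off the divisor `dσ` is injective, which determines `f · X^*` there,
-- and density determines it everywhere.
lemma IsPullback.eq_zeta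
    (hinj : ∀ y ∉ σ ⁻¹' C,
      Function.Injective (mfderiv 𝓘(𝕜, Fin n → 𝕜) 𝓘(𝕜, Fin n → 𝕜) σ y))
    {X : Field 𝕜 n M} {Φ : BlDer 𝕜 n (σ ⁻¹' C) q} (hΦ : IsPullback σ (σ ⁻¹' C) q X Φ)
    {V : Field 𝕜 n M'} (hV : FieldAnalyticAt V q) (h : ∀ᶠ y in 𝓝 q, RelatedAt σ V X y) :
    Φ = zeta 𝕜 n (σ ⁻¹' C) q (derOf V hV) := by
  refine LinearMap.ext fun f => Subtype.ext ?_
  obtain ⟨g, U, hfg, hU, hgU⟩ := hΦ f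
  obtain ⟨f, hfF⟩ := f
  obtain ⟨g', hg', rfl⟩ := exists_stalkOf_eq f
  have hgg : ∀ᶠ y in 𝓝 q, g' y = g y := Germ.coe_eq.1 hfg
  obtain ⟨U', hU', hUe⟩ := exists_derOf_eq (Φ ⟨stalkOf g' hg', hfF⟩)
  rw [hUe] at hU
  have hUa : FieldAnalyticAt U q := hU'.congr (fieldGerm_eq_iff.1 hU)
  have hgV : FieldAnalyticAt (fun y => g' y • V y) q := ContMDiffAt.smul_section hg' hV
  rw [hUe]
  refine hU.trans (fieldGerm_eq_iff (Y := fun y => g' y • V y).2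
    (eventuallyEq_of_eq_off hdense hUa hgV ?_))
  filter_upwards [hgg, hgU, h] with y h1 h2 h3 hy
  refine hinj y hy ?_
  rw [h2, map_smul, h3, h1]

/-- Generators of the adapted analytic strict transform, if the pull-backs of generators of `θ`
are analytic and leave the ideal of the exceptional divisor invariant. -/
lemma adaptedTransform_generate {θ : StalkFamily 𝕜 n M}
    (hσ : ContMDiff 𝓘(𝕜, Fin n → 𝕜) 𝓘(𝕜, Fin n → 𝕜) ω σ)
    (hinj : ∀ y ∉ σ ⁻¹' C,
      Function.Injective (mfderiv 𝓘(𝕜, Fin n → 𝕜) 𝓘(𝕜, Fin n → 𝕜) σ y))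
    {ι : Type*} [Fintype ι] {X : ι → Field 𝕜 n M} {Y : ι → Field 𝕜 n M'}
    (hX : (θ (σ q)).map (DerStalk 𝕜 n (σ q)).subtype =
      Submodule.span (Stalk 𝕜 n (σ q)) (Set.range fun i => fieldGerm (σ q) (X i)))
    (hY : ∀ i, FieldAnalyticAt (Y i) q)
    (hXY : ∀ i, ∀ᶠ y in 𝓝 q, RelatedAt σ (Y i) (X i) y)
    (hF : ∀ i, Preserves (Y i) (σ ⁻¹' C) q) :
    (adaptedTransform σ C θ q).map (DerStalk 𝕜 n q).subtype =
      Submodule.span (Stalk 𝕜 n q) (Set.range fun i => fieldGerm q (Y i)) := by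
  have hspan : Submodule.span (Stalk 𝕜 n q) (Set.range fun i => fieldGerm q (Y i)) =
      (Submodule.span (Stalk 𝕜 n q) (Set.range fun i => derOf (Y i) (hY i))).map
        (DerStalk 𝕜 n q).subtype := by
    rw [Submodule.map_span, ← Set.range_comp]; rfl
  rw [hspan]
  congr 1
  refine le_antisymm ?_ (Submodule.span_le.2 ?_)
  · intro w hw
    -- If `W = ∑ a i • X i`, the pull-back of `W` is `∑ (a i ∘ σ) • Y i`, which has no pole. Thus
    -- the total transform already lies in the image of `zeta`.
    have hle : totalTransform σ C θ q ≤
        (Submodule.span (Stalk 𝕜 n q) (Set.range fun i => derOf (Y i) (hY i))).map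
          (zeta 𝕜 n (σ ⁻¹' C) q) := by
      refine Submodule.span_le.2 ?_
      rintro Φ ⟨W, hW, hΦ⟩
      rw [StalkFamily.mem_iff, hX] at hW
      obtain ⟨a, ha, hWa⟩ := mem_span_germs.1 hW
      have haσ : ∀ i, FunAnalyticAt 𝕜 n (fun y => a i (σ y)) q := fun i =>
        ContMDiffAt.comp q (ha i) (hσ q)
      refine ⟨_, ?_, (hΦ.eq_zeta hdense hinj (FieldAnalyticAt.sum Finset.univ haσ hY) ?_).symm⟩
      · rw [derOf_sum Finset.univ haσ hY]
        exact Submodule.sum_mem _ fun i _ =>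
          Submodule.smul_mem _ _ (Submodule.subset_span ⟨i, rfl⟩)
      · filter_upwards [eventually_all.2 hXY, hσ.continuous.continuousAt.eventually hWa]
          with y h1 h2
        exact (RelatedAt.sum h1 a).trans h2.symm
    obtain ⟨v, hv, hvw⟩ := hle hw.1
    rwa [← zeta_injective hdense hf hf0 hvw]
  -- Tangency to the exceptional divisor enters only here: the `Y i` already generate the analytic
  -- strict transform, and the logarithmic condition removes nothing.
  · rintro _ ⟨i, rfl⟩
    refine ⟨Submodule.subset_span ⟨X i, ?_, isPullback_zeta (hY i) (hXY i)⟩,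
      derOf_mem_logDer (hY i) (hF i)⟩
    rw [StalkFamily.mem_iff, hX]
    exact Submodule.subset_span ⟨i, rfl⟩

end Transform

/-! ### The blowing-up away from the centre -/

section OffCentre

variable {𝕜 : Type*} [RCLike 𝕜] {n : ℕ}
variable {M : Type*} [TopologicalSpace M] [ChartedSpace (Fin n → 𝕜) M]
  [IsManifold 𝓘(𝕜, Fin n → 𝕜) ω M]
variable {M' : Type*} [TopologicalSpace M'] [ChartedSpace (Fin n → 𝕜) M']
  [IsManifold 𝓘(𝕜, Fin n → 𝕜) ω M']
variable {σ : M' → M} {C : Set M}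

omit [IsManifold 𝓘(𝕜, Fin n → 𝕜) ω M] [IsManifold 𝓘(𝕜, Fin n → 𝕜) ω M'] in
/-- Off the exceptional divisor, the blowing-up is a local isomorphism. -/
lemma IsBlowup.isInvertible_mfderiv (hσ : IsBlowup 𝕜 n σ C) (hC : IsClosed C) {y : M'}
    (hy : σ y ∉ C) : (mfderiv 𝓘(𝕜, Fin n → 𝕜) 𝓘(𝕜, Fin n → 𝕜) σ y).IsInvertible := by
  obtain ⟨τ, hτ, hστ, hτσ⟩ := hσ.iso
  have hσd : MDifferentiableAt 𝓘(𝕜, Fin n → 𝕜) 𝓘(𝕜, Fin n → 𝕜) σ y :=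
    (hσ.analytic y).mdifferentiableAt (by simp)
  have hσd' : MDifferentiableAt 𝓘(𝕜, Fin n → 𝕜) 𝓘(𝕜, Fin n → 𝕜) σ (τ (σ y)) :=
    (hσ.analytic _).mdifferentiableAt (by simp)
  have hτd : MDifferentiableAt 𝓘(𝕜, Fin n → 𝕜) 𝓘(𝕜, Fin n → 𝕜) τ (σ y) :=
    (hτ.contMDiffAt (hC.isOpen_compl.mem_nhds hy)).mdifferentiableAt (by simp)
  have h1 := (mfderiv_comp y hτd hσd).symm.trans ((show τ ∘ σ =ᶠ[𝓝 y] id by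
    filter_upwards [(hC.isOpen_compl.preimage hσ.analytic.continuous).mem_nhds hy] with z hz
    exact hτσ z hz).mfderiv_eq.trans mfderiv_id)
  have h2 := (mfderiv_comp (σ y) hσd' hτd).symm.trans ((show σ ∘ τ =ᶠ[𝓝 (σ y)] id by
    filter_upwards [hC.isOpen_compl.mem_nhds hy] with z hz
    exact hστ z hz).mfderiv_eq.trans mfderiv_id)
  have h3 := hτσ y hy
  refine ⟨ContinuousLinearEquiv.equivOfInverse _
    (mfderiv 𝓘(𝕜, Fin n → 𝕜) 𝓘(𝕜, Fin n → 𝕜) τ (σ y)) (fun v => ?_) (fun v => ?_), rfl⟩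
  · exact congrArg (fun L => L v) h1
  · rw [h3] at h2
    exact congrArg (fun L => L v) h2

end OffCentre

/-! ### Coordinate hypersurfaces: divisibility, density and tangency -/

section Coordinates

variable {𝕜 : Type*} [RCLike 𝕜] {n : ℕ}
variable {M : Type*} [TopologicalSpace M] [ChartedSpace (Fin n → 𝕜) M]

lemma act_congr {Y : Field 𝕜 n M} {g h : M → 𝕜} {y : M} (hgh : g =ᶠ[𝓝 y] h) :
    act Y g y = act Y h y :=
  congrArg (fun L : (Fin n → 𝕜) →L[𝕜] 𝕜 => L (Y y)) (hgh.mfderiv_eq (I := 𝓘(𝕜, Fin n → 𝕜)))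

lemma act_mul {Y : Field 𝕜 n M} {g h : M → 𝕜} {y : M}
    (hg : MDifferentiableAt 𝓘(𝕜, Fin n → 𝕜) 𝓘(𝕜, 𝕜) g y)
    (hh : MDifferentiableAt 𝓘(𝕜, Fin n → 𝕜) 𝓘(𝕜, 𝕜) h y) :
    act Y (fun z => g z * h z) y = g y * act Y h y + h y * act Y g y :=
  congrArg (fun L : (Fin n → 𝕜) →L[𝕜] 𝕜 => L (Y y)) (hg.hasMFDerivAt.mul hh.hasMFDerivAt).mfderiv

variable {ψ : OpenPartialHomeomorph M (Fin n → 𝕜)}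
  (hψ : ψ ∈ IsManifold.maximalAtlas 𝓘(𝕜, Fin n → 𝕜) ω M)

include hψ

lemma hasMFDerivAt_chart_apply {y : M} (hy : y ∈ ψ.source) (i : Fin n) :
    HasMFDerivAt 𝓘(𝕜, Fin n → 𝕜) 𝓘(𝕜, 𝕜) (fun x => ψ x i) y
      ((ContinuousLinearMap.proj (R := 𝕜) (φ := fun _ : Fin n => 𝕜) i).comp
        (mfderiv 𝓘(𝕜, Fin n → 𝕜) 𝓘(𝕜, Fin n → 𝕜) ψ y)) :=
  (ContinuousLinearMap.proj (R := 𝕜) (φ := fun _ : Fin n => 𝕜) i).hasMFDerivAt.comp y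
    ((mdifferentiable_of_mem_maximalAtlas hψ).mdifferentiableAt hy).hasMFDerivAt

lemma act_chart_apply (X : Field 𝕜 n M) {y : M} (hy : y ∈ ψ.source) (i : Fin n) :
    act X (fun x => ψ x i) y = chartRep ψ X y i :=
  congrArg (fun L => L (X y)) (hasMFDerivAt_chart_apply hψ hy i).mfderiv

lemma funAnalyticAt_chart_apply {y : M} (hy : y ∈ ψ.source) (i : Fin n) :
    FunAnalyticAt 𝕜 n (fun x => ψ x i) y :=
  contMDiffAt_pi_space.1 (contMDiffAt_of_mem_maximalAtlas hψ hy) i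

lemma FunAnalyticAt.analyticAt_comp_symm {h : M → 𝕜} {q : M} (hh : FunAnalyticAt 𝕜 n h q)
    (hq : q ∈ ψ.source) : AnalyticAt 𝕜 (h ∘ ψ.symm) (ψ q) := by
  have hh' : FunAnalyticAt 𝕜 n h (ψ.symm (ψ q)) := by rwa [ψ.left_inv hq]
  exact ContDiffAt.analyticAt (ContMDiffAt.contDiffAt
    (ContMDiffAt.comp (ψ q) hh' (contMDiffAt_symm_of_mem_maximalAtlas hψ (ψ.map_source hq))))

/-- An analytic function that vanishes where a coordinate vanishes is divisible by it. -/
lemma FunAnalyticAt.exists_eq_mul {h : M → 𝕜} {q : M} (hh : FunAnalyticAt 𝕜 n h q)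
    (hq : q ∈ ψ.source) {j : Fin n} (hj : ψ q j = 0)
    (h0 : ∀ᶠ y in 𝓝 q, ψ y j = 0 → h y = 0) :
    ∃ b : M → 𝕜, FunAnalyticAt 𝕜 n b q ∧ ∀ᶠ y in 𝓝 q, h y = ψ y j * b y := by
  have h0' : ∀ᶠ w in 𝓝 (ψ q), w j = 0 → (h ∘ ψ.symm) w = 0 := by
    have hc : Tendsto ψ.symm (𝓝 (ψ q)) (𝓝 q) := ψ.tendsto_symm hq
    filter_upwards [hc.eventually h0, ψ.open_target.mem_nhds (ψ.map_source hq)] with w h1 h2 hw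
    exact h1 (by rwa [ψ.right_inv h2])
  obtain ⟨b, hb, hb'⟩ := exists_analyticAt_eq_smul
    (ContinuousLinearMap.proj (R := 𝕜) (φ := fun _ : Fin n => 𝕜) j) (e := Pi.single j 1)
    (by simp) (hh.analyticAt_comp_symm hψ hq) hj h0'
  refine ⟨b ∘ ψ, ContMDiffAt.comp q hb.contDiffAt.contMDiffAt
    (contMDiffAt_of_mem_maximalAtlas hψ hq), ?_⟩
  filter_upwards [(ψ.continuousAt hq).eventually hb', ψ.open_source.mem_nhds hq] with y h1 h2
  rw [Function.comp_apply, ψ.left_inv h2] at h1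
  exact h1

omit [ChartedSpace (Fin n → 𝕜) M] hψ in
-- A point of `F` is a limit of points moved along the j-th coordinate axis, which leave `F` at
-- once.
lemma mem_closure_compl_of_chart {F : Set M} {j : Fin n}
    (hF : ∀ y ∈ ψ.source, y ∈ F ↔ ψ y j = 0) {y : M} (hy : y ∈ ψ.source) :
    y ∈ closure Fᶜ := by
  by_cases hyF : y ∈ F
  swap
  · exact subset_closure hyF
  have hc : Tendsto (fun t : 𝕜 => ψ y + t • (Pi.single j 1 : Fin n → 𝕜)) (𝓝[≠] 0)
      (𝓝 (ψ y)) := by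
    have : Continuous fun t : 𝕜 => ψ y + t • (Pi.single j 1 : Fin n → 𝕜) := by fun_prop
    simpa using (this.tendsto 0).mono_left nhdsWithin_le_nhds
  have hc' : Tendsto ψ.symm (𝓝 (ψ y)) (𝓝 y) := ψ.tendsto_symm hy
  refine mem_closure_of_tendsto (hc'.comp hc) ?_
  filter_upwards [hc.eventually (ψ.open_target.mem_nhds (ψ.map_source hy)),
    self_mem_nhdsWithin] with t h1 h2 h3
  have h4 := (hF _ (ψ.map_target h1)).1 h3
  rw [ψ.right_inv h1] at h4
  simp [(hF y hy).1 hyF] at h4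
  exact h2 h4

/-- A vector field whose `j`-th component vanishes on the coordinate hypersurface `F` given by the
vanishing of the `j`-th coordinate leaves the ideal of `F` invariant. -/
lemma preserves_of_chart [IsManifold 𝓘(𝕜, Fin n → 𝕜) ω M] {F : Set M} {j : Fin n}
    (hF : ∀ y ∈ ψ.source, y ∈ F ↔ ψ y j = 0) {Y : Field 𝕜 n M} {q : M} (hq : q ∈ ψ.source)
    (hY : ∀ᶠ y in 𝓝 q, ψ y j = 0 → chartRep ψ Y y j = 0) : Preserves Y F q := by
  intro g hg hg0
  filter_upwards [hg.eventually, hg0.eventually_nhds, hY, ψ.open_source.mem_nhds hq]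
    with y h1 h2 h3 hy hyF
  have hyj := (hF y hy).1 hyF
  have hd : DifferentiableAt 𝕜 (g ∘ ψ.symm) (ψ y) :=
    (h1.analyticAt_comp_symm hψ hy).differentiableAt
  have he : g =ᶠ[𝓝 y] (g ∘ ψ.symm) ∘ ψ := by
    filter_upwards [ψ.open_source.mem_nhds hy] with z hz
    rw [Function.comp_apply, Function.comp_apply, ψ.left_inv hz]
  have hm := (hd.hasFDerivAt.hasMFDerivAt.comp y
    ((mdifferentiable_of_mem_maximalAtlas hψ).mdifferentiableAt
      hy).hasMFDerivAt).congr_of_eventuallyEq he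
  have hact : act Y g y = fderiv 𝕜 (g ∘ ψ.symm) (ψ y) (chartRep ψ Y y) :=
    congrArg (fun L => L (Y y)) hm.mfderiv
  rw [hact]
  -- `Y(g)` at `y` is the derivative of `g` along the line with direction `Y y` in the chart. The
  -- j-th coordinate is zero along this line, so it stays in `F`, where `g` vanishes.
  have hl := (hd.hasFDerivAt.hasLineDerivAt (chartRep ψ Y y))
  refine HasDerivAt.unique hl ((hasDerivAt_const (0 : 𝕜) (0 : 𝕜)).congr_of_eventuallyEq ?_)
  have hc : Tendsto (fun t : 𝕜 => ψ y + t • chartRep ψ Y y) (𝓝 0) (𝓝 (ψ y)) := by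
    have : Continuous fun t : 𝕜 => ψ y + t • chartRep ψ Y y := by fun_prop
    simpa using this.tendsto 0
  filter_upwards [hc.eventually (ψ.open_target.mem_nhds (ψ.map_source hy)),
    ((ψ.tendsto_symm hy).comp hc).eventually h2] with t h4 h5
  refine h5 ((hF _ (ψ.map_target h4)).2 ?_)
  rw [ψ.right_inv h4]
  simp [hyj, h3 hyj]

end Coordinates

/-! ### Affine charts of the blowing-up and lifting of vector fields -/

section Model

variable {𝕜 : Type*} [RCLike 𝕜] {n : ℕ}
variable {M : Type*} [TopologicalSpace M] [ChartedSpace (Fin n → 𝕜) M]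
variable {M' : Type*} [TopologicalSpace M'] [ChartedSpace (Fin n → 𝕜) M']
variable {σ : M' → M} {C : Set M}

/-- The affine charts of a blowing-up. -/
lemma IsBlowup.exists_charts (hσ : IsBlowup 𝕜 n σ C) {q : M'} (hq : σ q ∈ C) :
    ∃ φ ∈ IsManifold.maximalAtlas 𝓘(𝕜, Fin n → 𝕜) ω M,
    ∃ ψ ∈ IsManifold.maximalAtlas 𝓘(𝕜, Fin n → 𝕜) ω M', ∃ S : Finset (Fin n), ∃ j ∈ S,
      CutOut 𝕜 n φ S C ∧ q ∈ ψ.source ∧ ∀ y ∈ ψ.source, σ y ∈ φ.source ∧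
        ∀ i, φ (σ y) i = if i ∈ S ∧ i ≠ j then ψ y i * ψ y j else ψ y i := by
  obtain ⟨φ, hφ, hqφ, S, hS, Ψ, hΨ, hψ⟩ := hσ.model (σ q) hq
  -- Some homogeneous coordinate of the line over `q` is not zero; it selects the affine chart.
  obtain ⟨j, hj⟩ := Function.ne_iff.1 (Ψ ⟨q, hqφ⟩).1.2.rep_nonzero
  obtain ⟨ψ, hψa, hψs, hψe⟩ := hψ j
  refine ⟨φ, hφ, ψ, hψa, S, j, j.2, hS, by rw [hψs]; exact ⟨hqφ, hj⟩, fun y hy => ?_⟩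
  have hy' := hy
  rw [hψs] at hy'
  obtain ⟨hyφ, hyj⟩ := hy'
  refine ⟨hyφ, fun i => ?_⟩
  -- The point lies on its line, so `x_i = c L_i` for all `i ∈ S`, whence `x_i = (L_i / L_j) x_j`.
  have hz := (Ψ ⟨y, hyφ⟩).2.2
  rw [Projectivization.submodule_eq, Submodule.mem_span_singleton] at hz
  obtain ⟨c, hc⟩ := hz
  rw [hψe y hyφ hy, ← hΨ ⟨y, hyφ⟩]
  have hjj : affineChart j (Ψ ⟨y, hyφ⟩) j = (Ψ ⟨y, hyφ⟩).1.1 j := by simp [affineChart]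
  split_ifs with h
  · have h1 := congrFun hc ⟨i, h.1⟩
    have h2 := congrFun hc j
    rw [hjj]
    simp only [affineChart, h, Pi.smul_apply, smul_eq_mul] at h1 h2 ⊢
    rw [← h1, ← h2]
    simp [h]
    field_simp
  · rw [affineChart, dif_neg h]

omit [ChartedSpace (Fin n → 𝕜) M] [ChartedSpace (Fin n → 𝕜) M'] in
-- All the equations `x_i`, `i ∈ S`, of the centre become multiples of `y_j`, and `x_j` is `y_j`
-- itself.
lemma CutOut.mem_preimage_iff {φ : OpenPartialHomeomorph M (Fin n → 𝕜)}
    {ψ : OpenPartialHomeomorph M' (Fin n → 𝕜)} {S : Finset (Fin n)} (hS : CutOut 𝕜 n φ S C)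
    {j : Fin n} (hj : j ∈ S) (hφψ : ∀ y ∈ ψ.source, σ y ∈ φ.source ∧
        ∀ i, φ (σ y) i = if i ∈ S ∧ i ≠ j then ψ y i * ψ y j else ψ y i) :
    ∀ y ∈ ψ.source, y ∈ σ ⁻¹' C ↔ ψ y j = 0 := by
  intro y hy
  obtain ⟨h1, h2⟩ := hφψ y hy
  rw [Set.mem_preimage, hS _ h1]
  constructor
  · intro h
    simpa [h2] using h j hj
  · intro h i hi
    by_cases hij : i = j
    · simp [h2, hij, h]
    · simp [h2, hi, hij, h]

/-- The complement of the exceptional divisor is dense. -/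
lemma IsBlowup.dense_compl (hσ : IsBlowup 𝕜 n σ C) (q : M') : q ∈ closure (σ ⁻¹' C)ᶜ := by
  by_cases hq : σ q ∈ C
  · obtain ⟨φ, hφ, ψ, hψ, S, j, hj, hS, hqψ, hφψ⟩ := hσ.exists_charts hq
    exact mem_closure_compl_of_chart (hS.mem_preimage_iff hj hφψ) hqψ
  · exact subset_closure hq

/-- The exceptional divisor has local equations. -/
lemma IsBlowup.exists_equation (hσ : IsBlowup 𝕜 n σ C) (hC : IsClosed C) (q : M') :
    ∃ f : M' → 𝕜, FunAnalyticAt 𝕜 n f q ∧ ∀ᶠ y in 𝓝 q, y ∈ σ ⁻¹' C ↔ f y = 0 := by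
  by_cases hq : σ q ∈ C
  · obtain ⟨φ, hφ, ψ, hψ, S, j, hj, hS, hqψ, hφψ⟩ := hσ.exists_charts hq
    refine ⟨fun y => ψ y j, funAnalyticAt_chart_apply hψ hqψ j, ?_⟩
    filter_upwards [ψ.open_source.mem_nhds hqψ] with y hy
    exact hS.mem_preimage_iff hj hφψ y hy
  · refine ⟨fun _ => 1, contMDiffAt_const, ?_⟩
    filter_upwards [(hC.isOpen_compl.preimage hσ.analytic.continuous).mem_nhds hq] with y hy
    simpa using hy

variable [IsManifold 𝓘(𝕜, Fin n → 𝕜) ω M] [IsManifold 𝓘(𝕜, Fin n → 𝕜) ω M']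

/-- Here σ is a local isomorphism, and tangency is vacuous because a neighbourhood of `q` misses the
divisor. -/
lemma IsBlowup.exists_lift_of_notMem (hσ : IsBlowup 𝕜 n σ C) (hC : IsClosed C) {q : M'}
    (hq : σ q ∉ C) {X : Field 𝕜 n M} (hX : FieldAnalyticAt X (σ q)) :
    ∃ Y : Field 𝕜 n M', FieldAnalyticAt Y q ∧
      ∀ᶠ y in 𝓝 q, RelatedAt σ Y X y ∧ Preserves Y (σ ⁻¹' C) y := by
  refine ⟨VectorField.mpullback 𝓘(𝕜, Fin n → 𝕜) 𝓘(𝕜, Fin n → 𝕜) σ X,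
    ContMDiffAt.mpullback_vectorField_preimage hX (hσ.analytic q)
      (hσ.isInvertible_mfderiv hC hq) le_rfl, ?_⟩
  have h := (hC.isOpen_compl.preimage hσ.analytic.continuous).mem_nhds hq
  filter_upwards [eventually_eventually_nhds.2 h] with y hy
  refine ⟨((hσ.isInvertible_mfderiv hC hy.self_of_nhds).inverse_apply_eq.1 rfl).symm, ?_⟩
  intro g _ _
  filter_upwards [hy] with z hz hzC
  exact absurd hzC hz

lemma IsBlowup.exists_lift_of_mem (hσ : IsBlowup 𝕜 n σ C) {q : M'} (hq : σ q ∈ C)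
    {X : Field 𝕜 n M} (hX : FieldAnalyticAt X (σ q)) (hXC : Preserves X C (σ q)) :
    ∃ Y : Field 𝕜 n M', FieldAnalyticAt Y q ∧
      ∀ᶠ y in 𝓝 q, RelatedAt σ Y X y ∧ Preserves Y (σ ⁻¹' C) y := by
  obtain ⟨φ, hφ, ψ, hψ, S, j, hj, hS, hqψ, hφψ⟩ := hσ.exists_charts hq
  have hF := hS.mem_preimage_iff hj hφψ
  have hqφ := (hφψ q hqψ).1
  have hqj : ψ q j = 0 := (hF q hqψ).1 hq
  have hσc : ContinuousAt σ q := hσ.analytic.continuous.continuousAt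
  have ha : ∀ i, FunAnalyticAt 𝕜 n (fun y => chartRep φ X (σ y) i) q := fun i =>
    ContMDiffAt.comp q (hX.chartRep_apply hφ hqφ i) (hσ.analytic q)
  -- For `i ∈ S` the function `x_i` vanishes on the centre, so invariance makes `X(x_i)` vanish
  -- there and `X(x_i) ∘ σ` vanish on `y_j = 0`. For other `i` the value of `b` is irrelevant.
  have hdiv : ∀ i : Fin n, ∃ b : M' → 𝕜, FunAnalyticAt 𝕜 n b q ∧
      ∀ᶠ y in 𝓝 q, i ∈ S → chartRep φ X (σ y) i = ψ y j * b y := by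
    intro i
    by_cases hi : i ∈ S
    swap
    · exact ⟨fun _ => 0, contMDiffAt_const, Eventually.of_forall fun y h => absurd h hi⟩
    have h1 := hXC _ (funAnalyticAt_chart_apply hφ hqφ i) (by
      filter_upwards [φ.open_source.mem_nhds hqφ] with x hx hxC
      exact (hS x hx).1 hxC i hi)
    obtain ⟨b, hb, hb'⟩ := (ha i).exists_eq_mul hψ hqψ hqj (by
      filter_upwards [hσc.eventually h1, ψ.open_source.mem_nhds hqψ] with y h2 hy hyj
      rw [← act_chart_apply hφ X (hφψ y hy).1]
      exact h2 ((hF y hy).2 hyj))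
    exact ⟨b, hb, hb'.mono fun y hy _ => hy⟩
  choose b hb hab using hdiv
  -- The components are forced by `x_j = y_j` and `x_i = y_i y_j`: `Y(y_j) = y_j b_j`, and the
  -- product rule `y_j b_i = y_j Y(y_i) + y_i Y(y_j)` gives `Y(y_i) = b_i - y_i b_j`. The j-th one
  -- vanishes on `y_j = 0`.
  set V : M' → Fin n → 𝕜 := fun y i => if i = j then ψ y j * b j y else
    if i ∈ S then b i y - ψ y i * b j y else chartRep φ X (σ y) i with hV
  have hVa : ContMDiffAt 𝓘(𝕜, Fin n → 𝕜) 𝓘(𝕜, Fin n → 𝕜) ω V q := by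
    refine contMDiffAt_pi_space.2 fun i => ?_
    simp only [hV]
    have hψa := fun i => funAnalyticAt_chart_apply hψ hqψ i
    split_ifs
    · exact ContMDiffAt.mul (hψa j) (hb j)
    · exact ContMDiffAt.sub (hb i) (ContMDiffAt.mul (hψa i) (hb j))
    · exact ha i
  refine ⟨ofChartRep ψ V, fieldAnalyticAt_ofChartRep hψ hqψ hVa, ?_⟩
  filter_upwards [eventually_all.2 hab, eventually_eventually_nhds.2 (ψ.open_source.mem_nhds hqψ)]
    with y h1 h2
  have hy : y ∈ ψ.source := h2.self_of_nhds
  have hyφ := (hφψ y hy).1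
  refine ⟨?_, preserves_of_chart hψ hF hy ?_⟩
  · refine mfderiv_chart_injective hφ hyφ (funext fun i => ?_)
    have hσd := ((hσ.analytic y).mdifferentiableAt (by simp)).hasMFDerivAt
    have h3 := (hasMFDerivAt_chart_apply hφ hyφ i).comp y hσd
    have hY : ∀ i, act (ofChartRep ψ V) (fun z => ψ z i) y = V y i := fun i =>
      (act_chart_apply hψ (ofChartRep ψ V) hy i).trans (congrFun (chartRep_ofChartRep hψ V hy) i)
    have h4 : act (ofChartRep ψ V) (fun z => φ (σ z) i) y = chartRep φ X (σ y) i := by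
      by_cases hi : i ∈ S ∧ i ≠ j
      · have h5 : (fun z => φ (σ z) i) =ᶠ[𝓝 y] fun z => ψ z i * ψ z j := by
          filter_upwards [h2] with z hz
          exact ((hφψ z hz).2 i).trans (if_pos hi)
        rw [act_congr h5, act_mul (hasMFDerivAt_chart_apply hψ hy i).mdifferentiableAt
          (hasMFDerivAt_chart_apply hψ hy j).mdifferentiableAt, hY, hY, h1 i hi.1]
        simp only [hV, hi, if_true, if_false]
        ring
      · have h5 : (fun z => φ (σ z) i) =ᶠ[𝓝 y] fun z => ψ z i := by
          filter_upwards [h2] with z hz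
          exact ((hφψ z hz).2 i).trans (if_neg hi)
        rw [act_congr h5, hY]
        by_cases hij : i = j
        · subst hij
          rw [h1 i hj]; simp [hV]
        · have : i ∉ S := fun h => hi ⟨h, hij⟩
          simp [hV, hij, this]
    exact (congrArg (fun L => L (ofChartRep ψ V y)) h3.mfderiv).symm.trans h4
  · filter_upwards [h2] with z hz hzj
    rw [chartRep_ofChartRep hψ V hz]
    simp [hV, hzj]

/-- An analytic vector field that leaves the ideal of the centre invariant has an analytic
pull-back by the blowing-up, which leaves the ideal of the exceptional divisor invariant. -/
theorem IsBlowup.exists_lift (hσ : IsBlowup 𝕜 n σ C) (hC : IsClosed C) {q : M'}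
    {X : Field 𝕜 n M} (hX : FieldAnalyticAt X (σ q)) (hXC : Preserves X C (σ q)) :
    ∃ Y : Field 𝕜 n M', FieldAnalyticAt Y q ∧
      ∀ᶠ y in 𝓝 q, RelatedAt σ Y X y ∧ Preserves Y (σ ⁻¹' C) y := by
  by_cases hq : σ q ∈ C
  · exact hσ.exists_lift_of_mem hq hX hXC
  · exact hσ.exists_lift_of_notMem hC hq hX

end Model

/-! ### Lifting of frames and involutivity of the transform -/

section Main

variable {𝕜 : Type*} [RCLike 𝕜] {n : ℕ}
variable {M : Type*} [TopologicalSpace M] [ChartedSpace (Fin n → 𝕜) M]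
  [IsManifold 𝓘(𝕜, Fin n → 𝕜) ω M]
variable {M' : Type*} [TopologicalSpace M'] [ChartedSpace (Fin n → 𝕜) M']
  [IsManifold 𝓘(𝕜, Fin n → 𝕜) ω M']
variable {σ : M' → M} {C : Set M}

lemma IsFrameAt.mem {ι : Type*} {θ : StalkFamily 𝕜 n M} {p : M} {X : ι → Field 𝕜 n M}
    (h : IsFrameAt θ p X) (i : ι) : θ.Mem p (X i) := by
  rw [StalkFamily.mem_iff, h.generate.self_of_nhds]
  exact Submodule.subset_span ⟨i, rfl⟩

lemma IsFrameAt.eventually {ι : Type*} [Finite ι] {θ : StalkFamily 𝕜 n M} {p : M}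
    {X : ι → Field 𝕜 n M} (h : IsFrameAt θ p X) : ∀ᶠ q in 𝓝 p, IsFrameAt θ q X := by
  filter_upwards [eventually_all.2 fun i => (h.analyticAt i).eventually,
    eventually_linearIndependent (IsManifold.chart_mem_maximalAtlas p) (mem_chart_source _ p)
      h.analyticAt h.linearIndependent, h.generate.eventually_nhds] with q h1 h2 h3
  exact ⟨h1, h2, h3⟩

/-- A frame of an invariant distribution lifts to a frame of the adapted analytic strict
transform. -/
theorem IsBlowup.exists_isFrameAt (hσ : IsBlowup 𝕜 n σ C) (hC : IsClosed C)
    {θ : StalkFamily 𝕜 n M} (hinv : IsInvariant θ C) {ι : Type*} [Fintype ι] {q : M'}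
    {X : ι → Field 𝕜 n M} (hX : IsFrameAt θ (σ q) X) :
    ∃ Y : ι → Field 𝕜 n M', IsFrameAt (adaptedTransform σ C θ) q Y ∧
      ∀ᶠ y in 𝓝 q, ∀ i, RelatedAt σ (Y i) (X i) y := by
  choose Y hYa hY using fun i => hσ.exists_lift hC (hX.analyticAt i) (hinv _ _ (hX.mem i))
  have hY' := eventually_all.2 hY
  refine ⟨Y, ⟨hYa, ?_, ?_⟩, hY'.mono fun y hy i => (hy i).1⟩
  -- `dσ` sends `Y i q` to `X i (σ q)`, and independent images have independent sources; injectivity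
  -- of `dσ`, which can fail on the divisor, is not needed.
  · refine LinearIndependent.of_comp
      (mfderiv 𝓘(𝕜, Fin n → 𝕜) 𝓘(𝕜, Fin n → 𝕜) σ q).toLinearMap ?_
    convert hX.linearIndependent using 1
    exact funext fun i => (hY i).self_of_nhds.1
  · obtain ⟨f, hf, hf0⟩ := hσ.exists_equation hC q
    filter_upwards [hσ.analytic.continuous.continuousAt.eventually hX.generate,
      eventually_all.2 fun i => (hYa i).eventually, hY'.eventually_nhds, hf.eventually,
      hf0.eventually_nhds] with y h1 h2 h3 h4 h5
    exact adaptedTransform_generate (Eventually.of_forall hσ.dense_compl) h4 h5 hσ.analytic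
      (fun z hz => (hσ.isInvertible_mfderiv hC hz).injective) h1 h2
      (fun i => h3.mono fun z hz => (hz i).1) (fun i => (h3.self_of_nhds i).2)

/-- Off the exceptional divisor, the elements of the transform are pull-backs of elements
of `θ`. -/
lemma IsBlowup.exists_eq_mpullback (hσ : IsBlowup 𝕜 n σ C) (hC : IsClosed C)
    {θ : StalkFamily 𝕜 n M} {ι : Type*} [Fintype ι] {y : M'} (hy : σ y ∉ C)
    {X : ι → Field 𝕜 n M} (hX : IsFrameAt θ (σ y) X) {Y : ι → Field 𝕜 n M'}
    (hY : IsFrameAt (adaptedTransform σ C θ) y Y)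
    (hXY : ∀ᶠ z in 𝓝 y, ∀ i, RelatedAt σ (Y i) (X i) z) {V : Field 𝕜 n M'}
    (hV : (adaptedTransform σ C θ).Mem y V) :
    ∃ V₀ : Field 𝕜 n M, θ.Mem (σ y) V₀ ∧
      V =ᶠ[𝓝 y] VectorField.mpullback 𝓘(𝕜, Fin n → 𝕜) 𝓘(𝕜, Fin n → 𝕜) σ V₀ := by
  obtain ⟨f, hf, hVf⟩ := hY.mem_iff.1 hV
  obtain ⟨τ, hτ, hστ, hτσ⟩ := hσ.iso
  have hτy := hτ.contMDiffAt (hC.isOpen_compl.mem_nhds hy)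
  have hfτ : ∀ i, FunAnalyticAt 𝕜 n (fun x => f i (τ x)) (σ y) := fun i =>
    ContMDiffAt.comp (σ y) (by rw [hτσ y hy]; exact hf i) hτy
  -- The coefficients of `V` in the lifted frame descend through the inverse `τ` of σ off the
  -- centre.
  refine ⟨fun x => ∑ i, f i (τ x) • X i x,
    hX.mem_iff.2 ⟨_, hfτ, Eventually.of_forall fun _ => rfl⟩, ?_⟩
  filter_upwards [hVf, hXY, (hC.isOpen_compl.preimage hσ.analytic.continuous).mem_nhds hy]
    with z h1 h2 hz
  refine ((hσ.isInvertible_mfderiv hC hz).inverse_apply_eq.2 ?_).symm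
  have h3 : ∑ i, f i z • Y i z = ∑ i, f i (τ (σ z)) • Y i z := by rw [hτσ z hz]
  rw [h1, h3]
  exact (RelatedAt.sum h2 fun i x => f i (τ x)).symm

/-- The adapted analytic strict transform of an invariant regular distribution is involutive. -/
theorem IsBlowup.isInvolutive_adaptedTransform (hσ : IsBlowup 𝕜 n σ C) (hC : IsClosed C)
    {θ : StalkFamily 𝕜 n M} (hinv : IsInvariant θ C) (hθ : IsInvolutive θ) {ι : Type*} [Fintype ι]
    (hX : ∀ p, ∃ X : ι → Field 𝕜 n M, IsFrameAt θ p X) :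
    IsInvolutive (adaptedTransform σ C θ) := by
  intro q V W hV hW
  obtain ⟨X, hX⟩ := hX (σ q)
  obtain ⟨Y, hY, hXY⟩ := hσ.exists_isFrameAt hC hinv hX
  have hVW : FieldAnalyticAt (VectorField.mlieBracket 𝓘(𝕜, Fin n → 𝕜) V W) q := by
    -- The bracket costs one derivative, but `ω + 1 = ω`.
    have : IsManifold 𝓘(𝕜, Fin n → 𝕜) (ω + 1) M' := inferInstanceAs (IsManifold _ ω M')
    have h := ContMDiffWithinAt.mlieBracketWithin_vectorField (n := ω) (m := ω)
      (contMDiffWithinAt_univ.2 hV.analyticAt) (contMDiffWithinAt_univ.2 hW.analyticAt)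
      uniqueMDiffOn_univ (Set.mem_univ q) (by simp)
    rw [VectorField.mlieBracketWithin_univ] at h
    exact contMDiffWithinAt_univ.1 h
  obtain ⟨f, hf, hVf⟩ := hY.mem_iff.1 hV
  obtain ⟨g, hg, hWg⟩ := hY.mem_iff.1 hW
  rw [StalkFamily.mem_iff, hY.generate.self_of_nhds]
  -- It remains to compare values at points off the divisor, where both fields are pull-backs and
  -- the bracket commutes with the pull-back.
  refine mem_span_germs_of_dense hY.analyticAt hY.linearIndependent hVW
    (Eventually.of_forall hσ.dense_compl) ?_
  filter_upwards [hσ.analytic.continuous.continuousAt.eventually hX.eventually, hY.eventually,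
    hXY.eventually_nhds, hVf.eventually_nhds, hWg.eventually_nhds,
    eventually_all.2 fun i => (hf i).eventually, eventually_all.2 fun i => (hg i).eventually]
    with y hX hY hXY hVf hWg hf hg hy
  obtain ⟨V₀, hV₀, hVe⟩ := hσ.exists_eq_mpullback hC hy hX hY hXY (hY.mem_iff.2 ⟨f, hf, hVf⟩)
  obtain ⟨W₀, hW₀, hWe⟩ := hσ.exists_eq_mpullback hC hy hX hY hXY (hY.mem_iff.2 ⟨g, hg, hWg⟩)
  obtain ⟨c, -, hc⟩ := hX.mem_iff.1 (hθ _ _ _ hV₀ hW₀)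
  have h1 : VectorField.mlieBracket 𝓘(𝕜, Fin n → 𝕜) V W y = ∑ i, c i (σ y) • Y i y := by
    rw [hVe.mlieBracket_vectorField_eq hWe, ← VectorField.mpullback_mlieBracket (n := ω)
      hV₀.analyticAt.mdifferentiableAt hW₀.analyticAt.mdifferentiableAt (hσ.analytic y) (by simp)]
    refine (hσ.isInvertible_mfderiv hC hy).inverse_apply_eq.2 ?_
    rw [hc.self_of_nhds]
    exact (RelatedAt.sum hXY.self_of_nhds c).symm
  rw [h1]
  exact Submodule.sum_mem _ fun i _ => Submodule.smul_mem _ _ (Submodule.subset_span ⟨i, rfl⟩)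

end Main
end Foliated

end

theorem mainTheorem5 {𝕜 : Type*} [RCLike 𝕜] {n : ℕ}
    {M : Type*} [TopologicalSpace M] [ChartedSpace (Fin n → 𝕜) M]
    [IsManifold 𝓘(𝕜, Fin n → 𝕜) ω M]
    {M' : Type*} [TopologicalSpace M'] [ChartedSpace (Fin n → 𝕜) M']
    [IsManifold 𝓘(𝕜, Fin n → 𝕜) ω M']
    {d l : ℕ} (θ : Foliated.StalkFamily 𝕜 n M) (E : Fin l → Set M)
    (hM : Foliated.IsFoliatedManifold θ E d) (hreg : Foliated.IsRegular θ)
    (C : Set M) (hC : Foliated.IsAdmissibleCenter 𝕜 n E C) (hinv : Foliated.IsInvariant θ C)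
    (σ : M' → M) (hσ : Foliated.IsBlowup 𝕜 n σ C) :
    Foliated.IsSingularDistribution (Foliated.adaptedTransform σ C θ) d ∧
      Foliated.IsRegular (Foliated.adaptedTransform σ C θ) := by
  have hX := hM.distribution.exists_isFrameAt hreg
  have hY : ∀ q, ∃ Y : Fin d → Foliated.Field 𝕜 n M',
      Foliated.IsFrameAt (Foliated.adaptedTransform σ C θ) q Y := fun q =>
    let ⟨_, hXq⟩ := hX (σ q)
    let ⟨Y, hYq, _⟩ := hσ.exists_isFrameAt hC.1 hinv hXq
    ⟨Y, hYq⟩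
  exact ⟨⟨Foliated.isCoherent_of_isFrameAt hY,
    hσ.isInvolutive_adaptedTransform hC.1 hinv hM.distribution.involutive hX,
    Foliated.hasLeafDim_of_isFrameAt hY⟩, Foliated.isRegular_of_isFrameAt hY⟩
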